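/- Let $\mathbb{L}^3$ be $\mathbb{R}^3$ with the Lorentzian inner product $\langle x,y\rangle = x_1y_1+x_2y_2-x_3y_3$. Let $\Omega\subset\mathbb{R}^2$ be a bounded domain whose boundary is a Jordan curve, let $\psi\colon\Omega\to\mathbb{R}$ be a smooth function whose graph $\Sigma=\{(x,y,\psi(x,y)) : (x,y)\in\Omega\}\subset\mathbb{L}^3$ is a maximal surface (spacelike with vanishing mean curvature), and let $\partial\Sigma=\overline{\Sigma}\setminus\Sigma$. Let $L\subset\partial\Sigma$ be a lightlike line segment with endpoints $a,b$, i.e. $a\neq b$ and $\langle b-a,b-a\rangle=0$. Let $X\colon\mathbb{D}\to\Sigma$ be an isothermal parametrization of $\Sigma$ by the open unit disk, i.e. a smooth bijection onto $\Sigma$ with $\langle X_u,X_u\rangle=\langle X_v,X_v\rangle>0$ and $\langle X_u,X_v\rangle=0$, where $w=u+iv$. Assume that $L$ has shrinking singularities at its endpoints: there are a bounded measurable map $\widehat X\colon\partial\mathbb{D}\to\mathbb{L}^3$ with $$X(w)=\frac1{2\pi}\int_0^{2\pi}\frac{1-|w|^2}{|e^{it}-w|^2}\,\widehat X(e^{it})\,dt\qquad(w\in\mathbb{D}),$$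 a point $w_0\in\partial\mathbb{D}$, and $\varepsilon,\delta>0$ such that $\widehat X(w_0e^{-it})=a$ for all $t\in(0,\varepsilon)$ and $\widehat X(w_0e^{it})=b$ for all $t\in(0,\delta)$. Let $\Phi(\zeta)=w_0\,\dfrac{i-\zeta}{i+\zeta}$, a Möbius transformation from the upper half plane onto $\mathbb{D}$ with $\Phi(0)=w_0$, and let $D^+=(0,\infty)\times(0,\pi)\subset D=\mathbb{R}\times(0,\pi)$. Then there is a real analytic immersion $F\colon D\to\mathbb{L}^3$ such that: 1. $F(r,\theta)=X(\Phi(re^{i\theta}))$ for all $(r,\theta)\in D^+$, and $F$ maps $D^+$ bijectively onto $\Sigma$; 2. $\theta\mapsto F(0,\theta)$ maps $(0,\pi)$ bijectively onto $L\setminus\{a,b\}$; 3. $F$ has zero mean curvature on all of $D$, i.e. (with subscripts denoting partial derivatives) $$\langle F_\theta,F_\theta\rangle\det(F_r,F_\theta,F_{rr})-2\langle F_r,F_\theta\rangle\det(F_r,F_\theta,F_{r\theta})+\langle F_r,F_r\rangle\det(F_r,F_\theta,F_{\theta\theta})=0,$$ which at points where the induced metric is nondegenerate says that the mean curvature vanishes;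 4. the extended surface is invariant under the point symmetry about the midpoint $(a+b)/2$ of $L$: $F(-r,\pi-\theta)=a+b-F(r,\theta)$ on $D$, and in particular $a+b-F(D)=F(D)$; 5. the extended surface is maximal except along $L$: for $(r,\theta)\in D$ with $r\neq0$, $F(r,\theta)\notin L$ and $F$ is spacelike with vanishing mean curvature at $(r,\theta)$. -/

import Mathlib

open scoped ContDiff

noncomputable section

/-- The underlying vector space of the Lorentz-Minkowski 3-space. -/
abbrev L3 : Type := Fin 3 → ℝ

/-- The Lorentzian inner product of signature `(+,+,-)`. -/
def lorentz (x y : L3) : ℝ := x 0 * y 0 + x 1 * y 1 - x 2 * y 2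

/-- A nonzero null vector. -/
def IsLightlike (v : L3) : Prop := v ≠ 0 ∧ lorentz v v = 0

/-- First partial derivative of a parametrized surface. -/
def partial1 (F : ℝ × ℝ → L3) (p : ℝ × ℝ) : L3 := fderiv ℝ F p (1, 0)

/-- Second partial derivative of a parametrized surface. -/
def partial2 (F : ℝ × ℝ → L3) (p : ℝ × ℝ) : L3 := fderiv ℝ F p (0, 1)

/-- Determinant of three vectors. If `n` is the Lorentzian cross product of `u` and `v`, then
`det3 u v w = lorentz n w`. -/
def det3 (u v w : L3) : ℝ := Matrix.det (Matrix.of ![u, v, w])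

/-- The zero mean curvature equation `G L - 2 F M + E N = 0` at a point, where `E, F, G` are the
coefficients of the (possibly degenerate) Lorentzian first fundamental form and `L, M, N` are those
of the second fundamental form with respect to the unnormalized normal, the Lorentzian cross product
of the two partial derivatives. At points where the first fundamental form is nondegenerate this
says that the mean curvature vanishes; the equation makes sense at lightlike points as well. -/
def HasZeroMeanCurvatureAt (S : ℝ × ℝ → L3) (p : ℝ × ℝ) : Prop :=
  lorentz (partial2 S p) (partial2 S p)
      * det3 (partial1 S p) (partial2 S p) (partial1 (partial1 S) p)
    - 2 * lorentz (partial1 S p) (partial2 S p)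
      * det3 (partial1 S p) (partial2 S p) (partial2 (partial1 S) p)
    + lorentz (partial1 S p) (partial1 S p)
      * det3 (partial1 S p) (partial2 S p) (partial2 (partial2 S) p) = 0

/-- The induced metric is positive definite (in particular the differential is injective). -/
def IsSpacelikeAt (S : ℝ × ℝ → L3) (p : ℝ × ℝ) : Prop :=
  ∀ v : ℝ × ℝ, v ≠ 0 → 0 < lorentz (fderiv ℝ S p v) (fderiv ℝ S p v)

/-- Maximal: spacelike with vanishing mean curvature. -/
def IsMaximalAt (S : ℝ × ℝ → L3) (p : ℝ × ℝ) : Prop :=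
  IsSpacelikeAt S p ∧ HasZeroMeanCurvatureAt S p

/-- A bounded domain in the plane whose boundary is a Jordan curve. -/
structure IsJordanDomain (Ω : Set (ℝ × ℝ)) : Prop where
  isOpen : IsOpen Ω
  isConnected : IsConnected Ω
  isBounded : Bornology.IsBounded Ω
  frontier_eq : ∃ γ : Circle → ℝ × ℝ,
    Continuous γ ∧ Function.Injective γ ∧ frontier Ω = Set.range γ

/-- The graph parametrization `(x, y) ↦ (x, y, ψ(x, y))`. -/
def graphMap (ψ : ℝ × ℝ → ℝ) (p : ℝ × ℝ) : L3 := ![p.1, p.2, ψ p]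

/-- The graph of `ψ` over `Ω`. -/
def graphSet (Ω : Set (ℝ × ℝ)) (ψ : ℝ × ℝ → ℝ) : Set L3 := graphMap ψ '' Ω

/-- The boundary of the graph of `ψ` over (the open set) `Ω`: the limit points of the graph that
do not belong to it. -/
def graphBoundary (Ω : Set (ℝ × ℝ)) (ψ : ℝ × ℝ → ℝ) : Set L3 :=
  closure (graphSet Ω ψ) \ graphSet Ω ψ

/-- The graph of the smooth function `ψ` over `Ω` is a maximal surface. -/
def IsMaximalGraph (Ω : Set (ℝ × ℝ)) (ψ : ℝ × ℝ → ℝ) : Prop :=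
  ContDiffOn ℝ ∞ ψ Ω ∧ ∀ p ∈ Ω, IsMaximalAt (graphMap ψ) p

/-- `X` restricts to an isothermal (conformal) parametrization of the surface `S` by the open
unit disk. -/
structure IsIsothermalParametrization (X : ℂ → L3) (S : Set L3) : Prop where
  smooth : ContDiffOn ℝ ∞ X (Metric.ball 0 1)
  bijOn : Set.BijOn X (Metric.ball 0 1) S
  pos : ∀ w ∈ Metric.ball (0 : ℂ) 1, 0 < lorentz (fderiv ℝ X w 1) (fderiv ℝ X w 1)
  eq_norm : ∀ w ∈ Metric.ball (0 : ℂ) 1,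
    lorentz (fderiv ℝ X w 1) (fderiv ℝ X w 1)
      = lorentz (fderiv ℝ X w Complex.I) (fderiv ℝ X w Complex.I)
  orthogonal : ∀ w ∈ Metric.ball (0 : ℂ) 1,
    lorentz (fderiv ℝ X w 1) (fderiv ℝ X w Complex.I) = 0

/-- The Poisson integral on the unit disk. -/
def poissonIntegral (g : Circle → L3) (w : ℂ) : L3 :=
  (2 * Real.pi)⁻¹ • ∫ t in (0 : ℝ)..(2 * Real.pi),
    ((1 - ‖w‖ ^ 2) / ‖(Circle.exp t : ℂ) - w‖ ^ 2) • g (Circle.exp t)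

/-- `g` is a (bounded) boundary function of `X`: `X` is the Poisson integral of `g`.
Such a `g` is determined by `X` up to null sets. -/
def IsBoundaryFunction (X : ℂ → L3) (g : Circle → L3) : Prop :=
  Measurable (fun t : ℝ => g (Circle.exp t)) ∧ (∃ C : ℝ, ∀ z, ‖g z‖ ≤ C) ∧
    ∀ w ∈ Metric.ball (0 : ℂ) 1, X w = poissonIntegral g w

/-- The boundary function of `X` (after modification on a null set) is constantly `a` on an open arc
of the unit circle ending at `w₀` and constantly `b` on an open arc starting at `w₀`
(counterclockwise). -/
def HasShrinkingSingularitiesAt (X : ℂ → L3) (w₀ : Circle) (a b : L3) : Prop :=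
  ∃ g : Circle → L3, IsBoundaryFunction X g ∧
    ∃ ε > 0, ∃ δ > 0, (∀ t ∈ Set.Ioo (0 : ℝ) ε, g (w₀ * Circle.exp (-t)) = a) ∧
      ∀ t ∈ Set.Ioo (0 : ℝ) δ, g (w₀ * Circle.exp t) = b

/-- The Möbius transformation from the upper half plane onto the unit disk sending
`0` to `w₀` and `i` to `0`. -/
def cayley (w₀ : Circle) (ζ : ℂ) : ℂ := w₀ * ((Complex.I - ζ) / (Complex.I + ζ))

/-- The blow-up map `(r, θ) ↦ r e^{iθ}`. -/
def blowUp (p : ℝ × ℝ) : ℂ := (p.1 : ℂ) * Complex.exp ((p.2 : ℂ) * Complex.I)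

/-- The strip `ℝ × (0, π)`. -/
def strip : Set (ℝ × ℝ) := {p | 0 < p.2 ∧ p.2 < Real.pi}

/-- The half strip `(0, ∞) × (0, π)`, which the blow-up map sends bijectively onto the upper
half plane. -/
def halfStrip : Set (ℝ × ℝ) := {p | 0 < p.1 ∧ 0 < p.2 ∧ p.2 < Real.pi}

end

/-! Pulled back to the upper half plane, the boundary values of `X` jump at `0`: they are `b` just
to the right and `a` just to the left. The harmonic extension of the pure jump is `b + (θ/π)(a -
b)`, which depends on the angle alone. What remains is the Poisson integral of data vanishing near
the jump, so it is the imaginary part of a Herglotz integral `J` that is holomorphic off the real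
axis and in a full disk about `0`, and commutes with conjugation (`exists_herglotz_representation`).

In polar coordinates the jump is no longer singular: `b + (θ/π)(a - b) + Im J(r e^{iθ})` is analytic
on the whole strip and sweeps out the open segment at `r = 0`. Since `(r, θ) ↦ (-r, π - θ)`
conjugates `r e^{iθ}`, it acts on the surface as the point symmetry.

The isothermal condition gives conformality for `r > 0`; the symmetry carries it to `r < 0`, and
continuity keeps its two equations at `r = 0`. With Laplace's equation in polar form
(`polarSweep_laplace`) these equations force zero mean curvature
(`hasZeroMeanCurvatureAt_of_polar`).

The delicate point is immersion at `r = 0`, where the metric degenerates. There `F_θ + i r F_r` is a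
holomorphic null curve `A(ζ)`, `ζ = r e^{iθ}`, with `A(0) = (a - b)/π`. If `F_r` were parallel to
`F_θ` at `r = 0`, the Gauss map of this curve would be real on the real axis with a critical point
at `0`, so it would take real values in the upper half plane arbitrarily near `0`. A real value
makes the Hermitian norm of `A` vanish, contradicting spacelikeness
(`deriv_nullCurve_not_parallel`). -/

section HerglotzIntegral

/-! ### The Herglotz kernel and the Poisson integral in the half plane. -/

open MeasureTheory intervalIntegral

/-- The Herglotz kernel of the upper half plane, in the angular variable `t` of the circle. -/
noncomputable def herglotzKernel (ζ : ℂ) (t : ℝ) : ℂ :=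
  ((Real.cos (t / 2) : ℂ) + Real.sin (t / 2) * ζ) / (Real.sin (t / 2) - Real.cos (t / 2) * ζ)

/-- The Herglotz integral of a density on the circle, as a function on the upper half plane. -/
noncomputable def herglotzIntegral (q : ℝ → ℝ) (ζ : ℂ) : ℂ :=
  ∫ t in -Real.pi..Real.pi, herglotzKernel ζ t * q t

theorem hasDerivAt_herglotzKernel (t : ℝ) (ζ : ℂ)
    (h : (Real.sin (t / 2) : ℂ) - Real.cos (t / 2) * ζ ≠ 0) :
    HasDerivAt (fun z => herglotzKernel z t)
      (1 / ((Real.sin (t / 2) : ℂ) - Real.cos (t / 2) * ζ) ^ 2) ζ := by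
  unfold herglotzKernel
  have h1 : HasDerivAt (fun z : ℂ => (Real.cos (t / 2) : ℂ) + Real.sin (t / 2) * z)
      (Real.sin (t / 2)) ζ := by
    simpa using ((hasDerivAt_id ζ).const_mul (Real.sin (t / 2) : ℂ)).const_add
      (Real.cos (t / 2) : ℂ)
  have h2 : HasDerivAt (fun z : ℂ => (Real.sin (t / 2) : ℂ) - Real.cos (t / 2) * z)
      (-Real.cos (t / 2)) ζ := by
    simpa using ((hasDerivAt_id ζ).const_mul (Real.cos (t / 2) : ℂ)).const_sub
      (Real.sin (t / 2) : ℂ)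
  refine (h1.div h2 h).congr_deriv (congrArg (· / _) ?_)
  have : (Real.sin (t / 2) : ℂ) ^ 2 + (Real.cos (t / 2) : ℂ) ^ 2 = 1 := by
    exact_mod_cast Real.sin_sq_add_cos_sq (t / 2)
  linear_combination this

theorem measurable_herglotzKernel (ζ : ℂ) : Measurable (herglotzKernel ζ) := by
  unfold herglotzKernel
  fun_prop

/-- The kernel has its pole at `ζ = tan (t/2)`. Compactness of the set carrying the density keeps
the denominators uniformly away from zero near `ζ`, so one may differentiate under the integral.
Real `ζ` are allowed, which yields the continuation across the axis. -/
theorem differentiableAt_herglotzIntegral {q : ℝ → ℝ} (hq : Measurable q) {C : ℝ}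
    (hC : ∀ t, |q t| ≤ C) {S : Set ℝ} (hS : IsCompact S) (hqS : ∀ t, t ∉ S → q t = 0) {ζ : ℂ}
    (hζ : ∀ t ∈ S, (Real.sin (t / 2) : ℂ) - Real.cos (t / 2) * ζ ≠ 0) :
    DifferentiableAt ℂ (herglotzIntegral q) ζ := by
  obtain ⟨κ, hκ, hκS⟩ := hS.exists_forall_le'
    (f := fun t : ℝ => ‖(Real.sin (t / 2) : ℂ) - Real.cos (t / 2) * ζ‖)
    (by fun_prop) (a := 0) (fun t ht => norm_pos_iff.2 (hζ t ht))
  have hC0 : 0 ≤ C := (abs_nonneg _).trans (hC 0)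
  have low : ∀ z ∈ Metric.ball ζ (κ / 2), ∀ t ∈ S,
      κ / 2 ≤ ‖(Real.sin (t / 2) : ℂ) - Real.cos (t / 2) * z‖ := by
    intro z hz t ht
    have h1 := hκS t ht
    have h2 : ‖(Real.cos (t / 2) : ℂ) * (z - ζ)‖ ≤ κ / 2 := by
      rw [norm_mul, Complex.norm_real, Real.norm_eq_abs]
      have := Real.abs_cos_le_one (t / 2)
      have h3 : ‖z - ζ‖ < κ / 2 := by simpa [dist_eq_norm] using hz
      nlinarith [norm_nonneg (z - ζ), abs_nonneg (Real.cos (t / 2))]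
    have h3 : (Real.sin (t / 2) : ℂ) - Real.cos (t / 2) * ζ =
        ((Real.sin (t / 2) : ℂ) - Real.cos (t / 2) * z) + Real.cos (t / 2) * (z - ζ) := by ring
    have h4 := norm_add_le ((Real.sin (t / 2) : ℂ) - Real.cos (t / 2) * z)
      (Real.cos (t / 2) * (z - ζ))
    rw [← h3] at h4
    linarith
  have hqm : Measurable (fun t => (q t : ℂ)) := Complex.measurable_ofReal.comp hq
  have hmeas : ∀ z, Measurable (fun t => herglotzKernel z t * (q t : ℂ)) := fun z =>
    (measurable_herglotzKernel z).mul hqm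
  have key := intervalIntegral.hasDerivAt_integral_of_dominated_loc_of_deriv_le
    (μ := volume) (a := -Real.pi) (b := Real.pi)
    (F := fun z t => herglotzKernel z t * (q t : ℂ))
    (F' := fun z t => 1 / ((Real.sin (t / 2) : ℂ) - Real.cos (t / 2) * z) ^ 2 * (q t : ℂ))
    (x₀ := ζ) (bound := fun _ => 1 / (κ / 2) ^ 2 * C) (s := Metric.ball ζ (κ / 2))
    (Metric.ball_mem_nhds _ (by positivity)) ?_ ?_ ?_ ?_ ?_ ?_
  · exact key.2.differentiableAt
  · exact Filter.Eventually.of_forall fun z => (hmeas z).aestronglyMeasurable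
  · refine (intervalIntegrable_const (c := (1 + ‖ζ‖) / κ * C)).mono_fun
      (hmeas ζ).aestronglyMeasurable (Filter.Eventually.of_forall fun t => ?_)
    have hb : 0 ≤ (1 + ‖ζ‖) / κ * C := by positivity
    change ‖herglotzKernel ζ t * (q t : ℂ)‖ ≤ ‖(1 + ‖ζ‖) / κ * C‖
    rw [Real.norm_of_nonneg hb]
    by_cases ht : t ∈ S
    · rw [norm_mul, Complex.norm_real, Real.norm_eq_abs]
      refine mul_le_mul ?_ (hC t) (abs_nonneg _) (by positivity)
      unfold herglotzKernel
      rw [norm_div]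
      refine div_le_div₀ (by positivity) ?_ hκ (hκS t ht)
      refine (norm_add_le _ _).trans ?_
      rw [norm_mul, Complex.norm_real, Complex.norm_real, Real.norm_eq_abs, Real.norm_eq_abs]
      nlinarith [Real.abs_cos_le_one (t / 2), Real.abs_sin_le_one (t / 2), norm_nonneg ζ]
    · simp only [hqS t ht, Complex.ofReal_zero, mul_zero, norm_zero]
      exact hb
  · refine Measurable.aestronglyMeasurable ?_
    exact Measurable.mul (by fun_prop) hqm
  · refine Filter.Eventually.of_forall fun t _ z hz => ?_
    have hb : 0 ≤ 1 / (κ / 2) ^ 2 * C := by positivity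
    by_cases ht : t ∈ S
    · rw [norm_mul, Complex.norm_real, Real.norm_eq_abs]
      refine mul_le_mul ?_ (hC t) (abs_nonneg _) (by positivity)
      rw [norm_div, norm_one, norm_pow]
      gcongr
      exact low z hz t ht
    · simpa only [hqS t ht, Complex.ofReal_zero, mul_zero, norm_zero] using hb
  · exact intervalIntegrable_const
  · refine Filter.Eventually.of_forall fun t _ z hz => ?_
    by_cases ht : t ∈ S
    · refine (hasDerivAt_herglotzKernel t z ?_).mul_const _
      exact norm_pos_iff.1 (lt_of_lt_of_le (by positivity) (low z hz t ht))
    · simpa only [hqS t ht, Complex.ofReal_zero, mul_zero] using hasDerivAt_const z (0 : ℂ)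

theorem herglotzIntegral_conj (q : ℝ → ℝ) (ζ : ℂ) :
    herglotzIntegral q (starRingEnd ℂ ζ) = starRingEnd ℂ (herglotzIntegral q ζ) := by
  unfold herglotzIntegral
  rw [intervalIntegral.integral_of_le (by linarith [Real.pi_pos]),
    intervalIntegral.integral_of_le (by linarith [Real.pi_pos]), ← integral_conj]
  refine integral_congr_ae (Filter.Eventually.of_forall fun t => ?_)
  simp only [herglotzKernel, map_mul, map_div₀, map_add, map_sub, Complex.conj_ofReal]

theorem sin_sub_cos_mul_ne_zero {ζ : ℂ} (hζ : ζ.im ≠ 0) (t : ℝ) :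
    (Real.sin t : ℂ) - Real.cos t * ζ ≠ 0 := by
  intro h
  have him := congrArg Complex.im h
  have hre := congrArg Complex.re h
  simp only [Complex.sub_im, Complex.ofReal_im, Complex.mul_im, Complex.ofReal_re, zero_mul,
    add_zero, Complex.zero_im, Complex.sub_re, Complex.mul_re, sub_zero, Complex.zero_re] at him hre
  have hc : Real.cos t = 0 := by
    rcases mul_eq_zero.1 (by linarith : Real.cos t * ζ.im = 0) with h | h
    · exact h
    · exact absurd h hζ
  have := Real.sin_sq_add_cos_sq t
  rw [hc] at hre this
  have hs : Real.sin t = 0 := by linarith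
  rw [hs] at this
  norm_num at this

theorem continuous_herglotzKernel {ζ : ℂ} (hζ : ζ.im ≠ 0) : Continuous (herglotzKernel ζ) := by
  unfold herglotzKernel
  refine Continuous.div (by fun_prop) (by fun_prop) fun t => sin_sub_cos_mul_ne_zero hζ _

theorem hasDerivAt_sin_sub_cos_mul (ζ : ℂ) (t : ℝ) :
    HasDerivAt (fun t : ℝ => (Real.sin (t / 2) : ℂ) - Real.cos (t / 2) * ζ)
      (1 / 2 * ((Real.cos (t / 2) : ℂ) + Real.sin (t / 2) * ζ)) t := by
  have h0 : HasDerivAt (fun t : ℝ => t / 2) (1 / 2) t := (hasDerivAt_id t).div_const 2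
  have h1 := (h0.sin).ofReal_comp
  have h2 := ((h0.cos).ofReal_comp).mul_const ζ
  refine (h1.sub h2).congr_deriv ?_
  push_cast
  ring

/-- The numerator of the kernel is twice the `t`-derivative of its denominator, so twice the
logarithm of the denominator is a primitive. The imaginary part of the integral is `2(π - arg ζ)`,
the harmonic measure of a half line up to a factor. -/
theorem integral_herglotzKernel_pos {ζ : ℂ} (hζ : 0 < ζ.im) :
    ∫ t in (0 : ℝ)..Real.pi, herglotzKernel ζ t = -(2 * Complex.log (-ζ)) := by
  have hd : ∀ t ∈ Set.uIcc 0 Real.pi, HasDerivAt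
      (fun t : ℝ => 2 * Complex.log ((Real.sin (t / 2) : ℂ) - Real.cos (t / 2) * ζ))
      (herglotzKernel ζ t) t := by
    intro t ht
    rw [Set.uIcc_of_le Real.pi_pos.le] at ht
    have hsl : (Real.sin (t / 2) : ℂ) - Real.cos (t / 2) * ζ ∈ Complex.slitPlane := by
      rcases ht.2.eq_or_lt with rfl | hlt
      · simp
      · right
        have : 0 < Real.cos (t / 2) :=
          Real.cos_pos_of_mem_Ioo ⟨by linarith [ht.1, Real.pi_pos], by linarith⟩
        simp only [Complex.sub_im, Complex.ofReal_im, Complex.mul_im, Complex.ofReal_re, zero_mul,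
          add_zero]
        nlinarith [mul_pos this hζ]
    refine (((hasDerivAt_sin_sub_cos_mul ζ t).clog_real hsl).const_mul 2).congr_deriv ?_
    unfold herglotzKernel
    ring
  rw [intervalIntegral.integral_eq_sub_of_hasDerivAt hd
    ((continuous_herglotzKernel hζ.ne').intervalIntegrable _ _)]
  simp

theorem integral_herglotzKernel_neg {ζ : ℂ} (hζ : 0 < ζ.im) :
    ∫ t in (-Real.pi)..(0 : ℝ), herglotzKernel ζ t = 2 * Complex.log ζ := by
  have hd : ∀ t ∈ Set.uIcc (-Real.pi) 0, HasDerivAt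
      -- At `t = -π` the denominator is `-1`, on the branch cut; the sign change moves the path into
      -- the slit plane.
      (fun t : ℝ => 2 * Complex.log (-((Real.sin (t / 2) : ℂ) - Real.cos (t / 2) * ζ)))
      (herglotzKernel ζ t) t := by
    intro t ht
    rw [Set.uIcc_of_le (by linarith [Real.pi_pos])] at ht
    have hsl : -((Real.sin (t / 2) : ℂ) - Real.cos (t / 2) * ζ) ∈ Complex.slitPlane := by
      rcases ht.1.eq_or_lt with rfl | hlt
      · simp [neg_div]
      · right
        have : 0 < Real.cos (t / 2) :=
          Real.cos_pos_of_mem_Ioo ⟨by linarith [ht.1, Real.pi_pos], by linarith [ht.2, Real.pi_pos]⟩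
        simp only [Complex.neg_im, Complex.sub_im, Complex.ofReal_im, Complex.mul_im,
          Complex.ofReal_re, zero_mul, add_zero]
        nlinarith [mul_pos this hζ]
    refine (((hasDerivAt_sin_sub_cos_mul ζ t).neg.clog_real hsl).const_mul 2).congr_deriv ?_
    unfold herglotzKernel
    rw [Pi.neg_apply, neg_div_neg_eq]
    ring
  rw [intervalIntegral.integral_eq_sub_of_hasDerivAt hd
    ((continuous_herglotzKernel hζ.ne').intervalIntegrable _ _)]
  simp [neg_div]

theorem im_herglotzKernel (ζ : ℂ) (t : ℝ) :
    (herglotzKernel ζ t).im =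
      ζ.im / ‖(Real.sin (t / 2) : ℂ) - Real.cos (t / 2) * ζ‖ ^ 2 := by
  unfold herglotzKernel
  rw [Complex.div_im, ← Complex.normSq_eq_norm_sq, ← sub_div]
  congr 1
  simp only [Complex.sub_im, Complex.ofReal_im, Complex.mul_im, Complex.ofReal_re, zero_mul,
    add_zero, Complex.sub_re, Complex.mul_re, sub_zero, Complex.add_re, Complex.add_im]
  linear_combination ζ.im * Real.sin_sq_add_cos_sq (t / 2)

/-- The Cayley transform carries the Poisson kernel of the disk to the imaginary part of the
Herglotz kernel. -/
theorem poissonKernel_cayley {ζ : ℂ} (hζ : 0 < ζ.im) (w₀ : Circle) (t : ℝ) :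
    (1 - ‖cayley w₀ ζ‖ ^ 2) / ‖((w₀ * Circle.exp t : Circle) : ℂ) - cayley w₀ ζ‖ ^ 2 =
      (herglotzKernel ζ t).im := by
  have hne : Complex.I + ζ ≠ 0 := fun h => by
    have := congrArg Complex.im h
    simp at this
    linarith
  have hD : (Real.sin (t / 2) : ℂ) - Real.cos (t / 2) * ζ ≠ 0 := sin_sub_cos_mul_ne_zero hζ.ne' _
  have hN : 0 < ‖Complex.I + ζ‖ := norm_pos_iff.2 hne
  have h1 : ‖cayley w₀ ζ‖ = ‖Complex.I - ζ‖ / ‖Complex.I + ζ‖ := by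
    simp [cayley, Circle.norm_coe]
  have h2 : ((w₀ * Circle.exp t : Circle) : ℂ) - cayley w₀ ζ =
      w₀ * Circle.exp (t / 2) * (-2 * ((Real.sin (t / 2) : ℂ) - Real.cos (t / 2) * ζ)) /
        (Complex.I + ζ) := by
    have e1 : Complex.exp (t * Complex.I) = Complex.exp ((t / 2 : ℝ) * Complex.I) ^ 2 := by
      rw [← Complex.exp_nat_mul]; congr 1; push_cast; ring
    have e2 := Complex.exp_mul_I ((t / 2 : ℝ) : ℂ)
    rw [← Complex.ofReal_cos, ← Complex.ofReal_sin] at e2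
    have e3 : (Real.sin (t / 2) : ℂ) ^ 2 + (Real.cos (t / 2) : ℂ) ^ 2 = 1 := by
      exact_mod_cast Real.sin_sq_add_cos_sq (t / 2)
    have e4 : (Complex.I - ζ) / (Complex.I + ζ) * (Complex.I + ζ) = Complex.I - ζ :=
      div_mul_cancel₀ _ hne
    rw [eq_div_iff hne]
    simp only [Circle.coe_mul, Circle.coe_exp, cayley]
    rw [e1, e2]
    linear_combination (-(w₀ : ℂ)) * e4 + w₀ * (Complex.I - ζ) * e3 +
      w₀ * ((Real.cos (t / 2) + Real.sin (t / 2) * Complex.I) * 2 * Real.sin (t / 2) -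
        (Complex.I - ζ) * Real.sin (t / 2) ^ 2) * Complex.I_sq
  have h3 : ‖Complex.I + ζ‖ ^ 2 - ‖Complex.I - ζ‖ ^ 2 = 4 * ζ.im := by
    rw [← Complex.normSq_eq_norm_sq, ← Complex.normSq_eq_norm_sq, Complex.normSq_apply,
      Complex.normSq_apply]
    simp
    ring
  have hD' := norm_pos_iff.2 hD
  rw [im_herglotzKernel, h1, h2, norm_div, norm_mul, norm_mul, norm_mul, Circle.norm_coe,
    Circle.norm_coe, norm_neg, RCLike.norm_ofNat]
  generalize ‖(Real.sin (t / 2) : ℂ) - Real.cos (t / 2) * ζ‖ = N at hD' ⊢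
  field_simp
  linear_combination h3

theorem intervalIntegrable_smul_of_bounded {𝕜 E : Type*} [NormedField 𝕜] [NormedAddCommGroup E]
    [NormedSpace 𝕜 E] {f : ℝ → 𝕜} (hf : Continuous f) {g : ℝ → E}
    (hg : AEStronglyMeasurable g volume) {C : ℝ} (hC : ∀ t, ‖g t‖ ≤ C) (u v : ℝ) :
    IntervalIntegrable (fun t => f t • g t) volume u v := by
  have hb : Continuous fun t => ‖f t‖ * C := hf.norm.mul continuous_const
  refine (hb.intervalIntegrable u v).mono_fun ((hf.aestronglyMeasurable.smul hg).restrict)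
    (Filter.Eventually.of_forall fun t => ?_)
  change ‖f t • g t‖ ≤ ‖‖f t‖ * C‖
  rw [norm_smul, Real.norm_of_nonneg
    (mul_nonneg (norm_nonneg _) ((norm_nonneg _).trans (hC t)))]
  exact mul_le_mul_of_nonneg_left (hC t) (norm_nonneg _)

/-- The Poisson integral in the coordinate of the upper half plane. -/
theorem poissonIntegral_cayley {g : Circle → L3} (w₀ : Circle)
    {ζ : ℂ} (hζ : 0 < ζ.im) :
    poissonIntegral g (cayley w₀ ζ) = (2 * Real.pi)⁻¹ •
      ∫ t in -Real.pi..Real.pi, (herglotzKernel ζ t).im • g (w₀ * Circle.exp t) := by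
  unfold poissonIntegral
  congr 1
  have hper : Function.Periodic (fun t : ℝ => ((1 - ‖cayley w₀ ζ‖ ^ 2) /
      ‖(Circle.exp t : ℂ) - cayley w₀ ζ‖ ^ 2) • g (Circle.exp t)) (2 * Real.pi) := by
    intro t
    simp only [Circle.exp_add_two_pi]
  -- The period is shifted so that the jump at `w₀` sits at `t = 0`.
  have h1 := hper.intervalIntegral_add_eq 0 (Complex.arg w₀ + -Real.pi)
  rw [zero_add, show Complex.arg w₀ + -Real.pi + 2 * Real.pi = Complex.arg w₀ + Real.pi by ring,
    ← intervalIntegral.integral_comp_add_left] at h1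
  rw [h1]
  refine intervalIntegral.integral_congr fun t _ => ?_
  simp only [Circle.exp_add, Circle.exp_arg]
  rw [poissonKernel_cayley hζ]

/-! ### Splitting the jump off the boundary data. -/

theorem blowUp_im (r θ : ℝ) : (blowUp (r, θ)).im = r * Real.sin θ := by
  simp [blowUp, Complex.exp_ofReal_mul_I_im]

theorem blowUp_re (r θ : ℝ) : (blowUp (r, θ)).re = r * Real.cos θ := by
  simp [blowUp, Complex.exp_ofReal_mul_I_re]

theorem arg_blowUp {r θ : ℝ} (hr : 0 < r) (hθ : 0 < θ) (hθ' : θ < Real.pi) :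
    Complex.arg (blowUp (r, θ)) = θ := by
  unfold blowUp
  simp only
  rw [Complex.exp_mul_I]
  exact Complex.arg_mul_cos_add_sin_mul_I hr ⟨by linarith, hθ'.le⟩

/-- Subtract from the boundary data the step function equal to `a` for `t < 0` and `b` for `t > 0`.
The step integrates explicitly to the term linear in `θ`; the difference vanishes near `t = 0` and
is the density of `J`. -/
theorem exists_herglotz_representation {X : ℂ → L3} {w₀ : Circle} {a b : L3}
    (hball : ∀ ζ : ℂ, 0 < ζ.im → cayley w₀ ζ ∈ Metric.ball (0 : ℂ) 1)
    (h : HasShrinkingSingularitiesAt X w₀ a b) :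
    ∃ J : Fin 3 → ℂ → ℂ, ∃ ρ > 0,
      (∀ j ζ, ζ.im ≠ 0 ∨ ‖ζ‖ < ρ → DifferentiableAt ℂ (J j) ζ) ∧
      (∀ j ζ, J j (starRingEnd ℂ ζ) = starRingEnd ℂ (J j ζ)) ∧
      ∀ j, ∀ r θ : ℝ, 0 < r → 0 < θ → θ < Real.pi →
        X (cayley w₀ (blowUp (r, θ))) j =
          b j + θ / Real.pi * (a j - b j) + (J j (blowUp (r, θ))).im := by
  obtain ⟨g, ⟨hgm, ⟨C, hC⟩, hXg⟩, ε, hε, δ, hδ, hga, hgb⟩ := h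
  have hpi := Real.pi_pos
  set η : ℝ := min (min ε δ) 1 with hη
  have hη0 : 0 < η := by positivity
  have hηε : η ≤ ε := (min_le_left _ _).trans (min_le_left _ _)
  have hηδ : η ≤ δ := (min_le_left _ _).trans (min_le_right _ _)
  have hη1 : η ≤ 1 := min_le_right _ _
  let S : Set ℝ := {t | η ≤ |t|} ∩ Set.Icc (-Real.pi) Real.pi
  have hScl : IsClosed {t : ℝ | η ≤ |t|} := isClosed_le continuous_const continuous_abs
  have hS : IsCompact S := isCompact_Icc.inter_left hScl
  have hSm : MeasurableSet S := hS.measurableSet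
  let G : ℝ → L3 := fun t => g (w₀ * Circle.exp t)
  have hGm : Measurable G := by
    have : G = (fun t => g (Circle.exp t)) ∘ (fun t => Complex.arg w₀ + t) := by
      ext1 t
      simp [G, Circle.exp_add, Circle.exp_arg]
    rw [this]
    exact hgm.comp (measurable_const_add _)
  -- Cutting off to `S` loses only `t = 0` inside the interval of integration, a null set. The
  -- factor absorbs the Poisson normalization.
  let q : Fin 3 → ℝ → ℝ := fun j =>
    S.indicator fun t => (2 * Real.pi)⁻¹ * (G t j - if 0 < t then b j else a j)
  have hqm : ∀ j, Measurable (q j) := fun j => by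
    refine Measurable.indicator (Measurable.const_mul (Measurable.sub ?_ ?_) _) hSm
    · exact (measurable_pi_apply j).comp hGm
    · exact Measurable.ite measurableSet_Ioi measurable_const measurable_const
  have hqC : ∀ j t, |q j t| ≤ (2 * Real.pi)⁻¹ * (C + (|b j| + |a j|)) := by
    intro j t
    have hCG : |G t j| ≤ C := (norm_le_pi_norm (G t) j).trans (hC _)
    have hC0 : 0 ≤ C := (abs_nonneg _).trans hCG
    by_cases ht : t ∈ S
    · simp only [q, Set.indicator_of_mem ht]
      rw [abs_mul, abs_of_pos (by positivity : 0 < (2 * Real.pi)⁻¹)]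
      refine mul_le_mul_of_nonneg_left ((abs_sub _ _).trans (add_le_add hCG ?_)) (by positivity)
      split_ifs
      · exact le_add_of_nonneg_right (abs_nonneg _)
      · exact le_add_of_nonneg_left (abs_nonneg _)
    · simp only [q, Set.indicator_of_notMem ht, abs_zero]
      positivity
  -- A pole at `ζ` forces `|sin (t/2)| ≤ ‖ζ‖`, while `|sin (t/2)| ≥ sin (η/2)` on `S`.
  refine ⟨fun j => herglotzIntegral (q j), Real.sin (η / 2),
    Real.sin_pos_of_pos_of_lt_pi (by linarith) (by linarith [Real.pi_gt_three]), ?_, ?_, ?_⟩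
  · intro j ζ hζ
    refine differentiableAt_herglotzIntegral (hqm j) (hqC j) hS
      (fun t ht => Set.indicator_of_notMem ht _) fun t ht => ?_
    rcases hζ with hζ | hζ
    · exact sin_sub_cos_mul_ne_zero hζ _
    · intro h0
      have h1 : ‖(Real.sin (t / 2) : ℂ)‖ = ‖(Real.cos (t / 2) : ℂ) * ζ‖ := by
        rw [sub_eq_zero.1 h0]
      rw [norm_mul, Complex.norm_real, Complex.norm_real, Real.norm_eq_abs,
        Real.norm_eq_abs] at h1
      have h2 : Real.sin (η / 2) ≤ |Real.sin (t / 2)| := by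
        have h3 : |Real.sin (t / 2)| = Real.sin (|t| / 2) := by
          have : |t| / 2 = |t / 2| := by rw [abs_div, abs_two]
          rw [this, Real.abs_sin_eq_sin_abs_of_abs_le_pi]
          rw [← this]
          have := abs_le.2 ht.2
          linarith
        rw [h3]
        have h4 := abs_le.2 ht.2
        have h5 : η ≤ |t| := ht.1
        exact Real.sin_le_sin_of_le_of_le_pi_div_two (by linarith) (by linarith) (by linarith)
      nlinarith [Real.abs_cos_le_one (t / 2), norm_nonneg ζ, abs_nonneg (Real.cos (t / 2))]
  · exact fun j ζ => herglotzIntegral_conj _ _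
  · intro j r θ hr hθ hθ'
    set ζ := blowUp (r, θ) with hζdef
    have hζ : 0 < ζ.im := by
      rw [hζdef, blowUp_im]
      exact mul_pos hr (Real.sin_pos_of_pos_of_lt_pi hθ hθ')
    have harg : Complex.arg ζ = θ := arg_blowUp hr hθ hθ'
    have hk := continuous_herglotzKernel hζ.ne'
    have hkim : Continuous fun t => (herglotzKernel ζ t).im := Complex.continuous_im.comp hk
    have hint : ∀ u v, IntervalIntegrable (fun t => (herglotzKernel ζ t).im • G t) volume u v :=
      intervalIntegrable_smul_of_bounded hkim hGm.aestronglyMeasurable fun t => hC _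
    have hintj : ∀ u v, IntervalIntegrable (fun t => (herglotzKernel ζ t).im * G t j)
        volume u v := fun u v =>
      intervalIntegrable_smul_of_bounded hkim
        ((measurable_pi_apply j).comp hGm).aestronglyMeasurable
        (fun t => (norm_le_pi_norm (G t) j).trans (hC _)) u v
    have hintq : ∀ u v, IntervalIntegrable (fun t => herglotzKernel ζ t * (q j t : ℂ))
        volume u v := fun u v =>
      intervalIntegrable_smul_of_bounded hk
        (Complex.measurable_ofReal.comp (hqm j)).aestronglyMeasurable
        (fun t => (Complex.norm_real _).trans_le (hqC j t)) u v
    have him : ∀ (f : ℝ → ℂ) (u v : ℝ), IntervalIntegrable f volume u v →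
        ∫ t in u..v, (f t).im = (∫ t in u..v, f t).im := fun f u v hf =>
      Complex.imCLM.intervalIntegral_comp_comm hf
    have himq : ∀ u v, IntervalIntegrable
        (fun t => 2 * Real.pi * (herglotzKernel ζ t * (q j t : ℂ)).im) volume u v := fun u v =>
      (show IntervalIntegrable (fun t => (herglotzKernel ζ t * (q j t : ℂ)).im) volume u v from
        ⟨(hintq u v).1.im, (hintq u v).2.im⟩).const_mul (2 * Real.pi)
    have hcst : ∀ c u v, IntervalIntegrable (fun t => (herglotzKernel ζ t).im * c) volume u v :=
      fun c u v => (hkim.intervalIntegrable u v).mul_const c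
    have hkey : ∀ t ∈ S, ∀ c, (c = if 0 < t then b j else a j) → (herglotzKernel ζ t).im * G t j =
        (herglotzKernel ζ t).im * c + 2 * Real.pi * (herglotzKernel ζ t * (q j t : ℂ)).im := by
      intro t ht c hc
      rw [Complex.im_mul_ofReal]
      simp only [q, Set.indicator_of_mem ht, ← hc]
      field_simp
      ring
    have hkey' : ∀ t ∉ S, ∀ c, G t j = c → (herglotzKernel ζ t).im * G t j =
        (herglotzKernel ζ t).im * c + 2 * Real.pi * (herglotzKernel ζ t * (q j t : ℂ)).im := by
      intro t ht c hc
      rw [Complex.im_mul_ofReal]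
      simp only [q, Set.indicator_of_notMem ht, hc]
      ring
    have hpos : ∫ t in (0 : ℝ)..Real.pi, (herglotzKernel ζ t).im * G t j =
        2 * (Real.pi - θ) * b j +
          2 * Real.pi * (∫ t in (0 : ℝ)..Real.pi, herglotzKernel ζ t * (q j t : ℂ)).im := by
      have e : ∫ t in (0 : ℝ)..Real.pi, (herglotzKernel ζ t).im * G t j =
          ∫ t in (0 : ℝ)..Real.pi, ((herglotzKernel ζ t).im * b j +
            2 * Real.pi * (herglotzKernel ζ t * (q j t : ℂ)).im) := by
        refine intervalIntegral.integral_congr_ae (Filter.Eventually.of_forall fun t ht => ?_)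
        rw [Set.uIoc_of_le hpi.le] at ht
        by_cases htS : t ∈ S
        · exact hkey t htS _ (if_pos ht.1).symm
        · refine hkey' t htS _ ?_
          have : t < η := by
            by_contra hcon
            exact htS ⟨by simpa [abs_of_pos ht.1] using hcon, by linarith [ht.1], ht.2⟩
          exact congrFun (hgb t ⟨ht.1, by linarith⟩) j
      rw [e, intervalIntegral.integral_add (hcst _ _ _) (himq _ _),
        intervalIntegral.integral_mul_const, intervalIntegral.integral_const_mul,
        him _ _ _ (hk.intervalIntegrable _ _), him _ _ _ (hintq _ _),
        integral_herglotzKernel_pos hζ]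
      have : Complex.arg (-ζ) = θ - Real.pi := by
        rw [Complex.arg_neg_eq_arg_sub_pi_of_im_pos hζ, harg]
      simp [Complex.log_im, this]
      ring
    have hneg : ∫ t in (-Real.pi)..(0 : ℝ), (herglotzKernel ζ t).im * G t j =
        2 * θ * a j +
          2 * Real.pi * (∫ t in (-Real.pi)..(0 : ℝ), herglotzKernel ζ t * (q j t : ℂ)).im := by
      have e : ∫ t in (-Real.pi)..(0 : ℝ), (herglotzKernel ζ t).im * G t j =
          ∫ t in (-Real.pi)..(0 : ℝ), ((herglotzKernel ζ t).im * a j +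
            2 * Real.pi * (herglotzKernel ζ t * (q j t : ℂ)).im) := by
        refine intervalIntegral.integral_congr_ae ?_
        -- The value of `g` at `w₀` itself is unconstrained.
        filter_upwards [Measure.ae_ne volume (0 : ℝ)] with t ht0 ht
        rw [Set.uIoc_of_le (by linarith)] at ht
        have ht1 : t < 0 := lt_of_le_of_ne ht.2 ht0
        by_cases htS : t ∈ S
        · exact hkey t htS _ (if_neg (by linarith)).symm
        · refine hkey' t htS _ ?_
          have : -t < η := by
            by_contra hcon
            exact htS ⟨by simpa [abs_of_neg ht1] using hcon, ht.1.le, by linarith⟩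
          have h1 := hga (-t) ⟨by linarith, by linarith⟩
          rw [neg_neg] at h1
          exact congrFun h1 j
      rw [e, intervalIntegral.integral_add (hcst _ _ _) (himq _ _),
        intervalIntegral.integral_mul_const, intervalIntegral.integral_const_mul,
        him _ _ _ (hk.intervalIntegrable _ _), him _ _ _ (hintq _ _),
        integral_herglotzKernel_neg hζ]
      simp [Complex.log_im, harg]
    rw [hXg _ (hball ζ hζ), poissonIntegral_cayley w₀ hζ, Pi.smul_apply, smul_eq_mul]
    have e : (∫ t in -Real.pi..Real.pi, (herglotzKernel ζ t).im • g (w₀ * Circle.exp t)) j =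
        ∫ t in -Real.pi..Real.pi, (herglotzKernel ζ t).im * G t j :=
      ((ContinuousLinearMap.proj (R := ℝ) (φ := fun _ : Fin 3 => ℝ) j).intervalIntegral_comp_comm
        (hint _ _)).symm
    rw [e, ← intervalIntegral.integral_add_adjacent_intervals (hintj (-Real.pi) 0)
      (hintj 0 Real.pi), hpos, hneg]
    simp only [herglotzIntegral]
    rw [← intervalIntegral.integral_add_adjacent_intervals (hintq (-Real.pi) 0)
      (hintq 0 Real.pi), Complex.add_im]
    field_simp
    ring

end HerglotzIntegral

/-! ### Derivatives of the polar sweep and the mean curvature equation. -/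

theorem partial1_eq_of_hasDerivAt {F : ℝ × ℝ → L3} {r θ : ℝ} {v : L3}
    (hF : DifferentiableAt ℝ F (r, θ)) (h : HasDerivAt (fun s => F (s, θ)) v r) :
    partial1 F (r, θ) = v :=
  (hF.hasFDerivAt.comp_hasDerivAt r ((hasDerivAt_id r).prodMk (hasDerivAt_const r θ))).unique h

theorem partial2_eq_of_hasDerivAt {F : ℝ × ℝ → L3} {r θ : ℝ} {v : L3}
    (hF : DifferentiableAt ℝ F (r, θ)) (h : HasDerivAt (fun s => F (r, s)) v θ) :
    partial2 F (r, θ) = v :=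
  (hF.hasFDerivAt.comp_hasDerivAt θ ((hasDerivAt_const θ r).prodMk (hasDerivAt_id θ))).unique h

theorem isOpen_strip : IsOpen strip :=
  (isOpen_lt continuous_const continuous_snd).inter (isOpen_lt continuous_snd continuous_const)

theorem hasDerivAt_blowUp_left (r θ : ℝ) :
    HasDerivAt (fun s : ℝ => blowUp (s, θ)) (Complex.exp (θ * Complex.I)) r := by
  unfold blowUp
  simpa using ((hasDerivAt_id r).ofReal_comp).mul_const (Complex.exp (θ * Complex.I))

theorem hasDerivAt_blowUp_right (r θ : ℝ) :
    HasDerivAt (fun s : ℝ => blowUp (r, s)) (Complex.I * blowUp (r, θ)) θ := by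
  unfold blowUp
  refine ((((hasDerivAt_id θ).ofReal_comp).mul_const Complex.I).cexp.const_mul
    (r : ℂ)).congr_deriv ?_
  simp
  ring

theorem analyticAt_blowUp (p : ℝ × ℝ) : AnalyticAt ℝ blowUp p := by
  unfold blowUp
  have h1 : AnalyticAt ℝ (fun p : ℝ × ℝ => (p.1 : ℂ)) p :=
    (Complex.ofRealCLM.comp (ContinuousLinearMap.fst ℝ ℝ ℝ)).analyticAt p
  have h2 : AnalyticAt ℝ (fun p : ℝ × ℝ => (p.2 : ℂ)) p :=
    (Complex.ofRealCLM.comp (ContinuousLinearMap.snd ℝ ℝ ℝ)).analyticAt p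
  have h3 : AnalyticAt ℝ Complex.exp ((p.2 : ℂ) * Complex.I) :=
    (Complex.differentiable_exp.analyticAt _).restrictScalars
  exact h1.mul (h3.comp (f := fun p : ℝ × ℝ => (p.2 : ℂ) * Complex.I) (h2.mul analyticAt_const))

/-- The surface swept out by the segment from `b` to `a`, plus the imaginary part of a holomorphic
curve in polar coordinates. -/
noncomputable def polarSweep (a b : L3) (J : Fin 3 → ℂ → ℂ) (p : ℝ × ℝ) : L3 := fun j =>
  b j + p.2 / Real.pi * (a j - b j) + (J j (blowUp p)).im

section PolarSweep

variable {a b : L3} {J : Fin 3 → ℂ → ℂ} {V : Set ℂ}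

theorem analyticAt_polarSweep {p : ℝ × ℝ} (hJ : ∀ j, AnalyticAt ℂ (J j) (blowUp p)) :
    AnalyticAt ℝ (polarSweep a b J) p := by
  rw [analyticAt_pi_iff]
  intro j
  have h2 : AnalyticAt ℝ (fun p : ℝ × ℝ => p.2) p :=
    (ContinuousLinearMap.snd ℝ ℝ ℝ).analyticAt p
  have h3 : AnalyticAt ℝ (fun p => (J j (blowUp p)).im) p :=
    (Complex.imCLM.analyticAt _).comp ((hJ j).restrictScalars.comp (analyticAt_blowUp p))
  exact (analyticAt_const.add ((h2.div_const).mul analyticAt_const)).add h3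

theorem partial1_polarSweep {r θ : ℝ} (hJ : ∀ j, AnalyticAt ℂ (J j) (blowUp (r, θ))) :
    partial1 (polarSweep a b J) (r, θ) =
      fun j => (deriv (J j) (blowUp (r, θ)) * Complex.exp (θ * Complex.I)).im := by
  refine partial1_eq_of_hasDerivAt (analyticAt_polarSweep hJ).differentiableAt
    (hasDerivAt_pi.2 fun j => ?_)
  have h := ((hJ j).differentiableAt.hasDerivAt.comp_of_eq r (hasDerivAt_blowUp_left r θ) rfl)
  exact (Complex.imCLM.hasFDerivAt.comp_hasDerivAt r h).const_add
    (b j + θ / Real.pi * (a j - b j))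

theorem partial2_polarSweep {r θ : ℝ} (hJ : ∀ j, AnalyticAt ℂ (J j) (blowUp (r, θ))) :
    partial2 (polarSweep a b J) (r, θ) = fun j =>
      (a j - b j) / Real.pi + (blowUp (r, θ) * deriv (J j) (blowUp (r, θ))).re := by
  refine partial2_eq_of_hasDerivAt (analyticAt_polarSweep hJ).differentiableAt
    (hasDerivAt_pi.2 fun j => ?_)
  have h := ((hJ j).differentiableAt.hasDerivAt.comp_of_eq θ (hasDerivAt_blowUp_right r θ) rfl)
  have h1 : HasDerivAt (fun s : ℝ => b j + s / Real.pi * (a j - b j))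
      (1 / Real.pi * (a j - b j)) θ :=
    (((hasDerivAt_id θ).div_const Real.pi).mul_const (a j - b j)).const_add (b j)
  refine (h1.add (Complex.imCLM.hasFDerivAt.comp_hasDerivAt θ h)).congr_deriv ?_
  simp
  ring

theorem partial1_partial1_polarSweep (hV : ∀ j, AnalyticOnNhd ℂ (J j) V)
    (hs : ∀ p ∈ strip, blowUp p ∈ V) {r θ : ℝ} (hp : (r, θ) ∈ strip) :
    partial1 (partial1 (polarSweep a b J)) (r, θ) = fun j =>
      (deriv (deriv (J j)) (blowUp (r, θ)) * Complex.exp (θ * Complex.I) ^ 2).im := by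
  have hd : DifferentiableAt ℝ (partial1 (polarSweep a b J)) (r, θ) :=
    ((analyticAt_polarSweep fun j => hV j _ (hs _ hp)).fderiv.differentiableAt).clm_apply
      (differentiableAt_const _)
  refine partial1_eq_of_hasDerivAt hd ?_
  have heq : (fun s => partial1 (polarSweep a b J) (s, θ)) = fun s j =>
      (deriv (J j) (blowUp (s, θ)) * Complex.exp (θ * Complex.I)).im :=
    funext fun s => partial1_polarSweep fun j => hV j _ (hs (s, θ) hp)
  rw [heq]
  refine hasDerivAt_pi.2 fun j => ?_
  have h := (((hV j _ (hs _ hp)).deriv.differentiableAt.hasDerivAt.comp_of_eq r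
    (hasDerivAt_blowUp_left r θ) rfl).mul_const (Complex.exp (θ * Complex.I)))
  refine (Complex.imCLM.hasFDerivAt.comp_hasDerivAt r h).congr_deriv ?_
  rw [pow_two, ← mul_assoc]
  rfl

theorem partial2_partial2_polarSweep (hV : ∀ j, AnalyticOnNhd ℂ (J j) V)
    (hs : ∀ p ∈ strip, blowUp p ∈ V) {r θ : ℝ} (hp : (r, θ) ∈ strip) :
    partial2 (partial2 (polarSweep a b J)) (r, θ) = fun j =>
      -(blowUp (r, θ) * deriv (J j) (blowUp (r, θ)) +
        blowUp (r, θ) ^ 2 * deriv (deriv (J j)) (blowUp (r, θ))).im := by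
  have hd : DifferentiableAt ℝ (partial2 (polarSweep a b J)) (r, θ) :=
    ((analyticAt_polarSweep fun j => hV j _ (hs _ hp)).fderiv.differentiableAt).clm_apply
      (differentiableAt_const _)
  refine partial2_eq_of_hasDerivAt hd ?_
  have heq : (fun s => partial2 (polarSweep a b J) (r, s)) =ᶠ[nhds θ] fun s j =>
      (a j - b j) / Real.pi + (blowUp (r, s) * deriv (J j) (blowUp (r, s))).re := by
    filter_upwards [isOpen_Ioo.mem_nhds (show θ ∈ Set.Ioo 0 Real.pi from hp)] with s hs'
    exact partial2_polarSweep fun j => hV j _ (hs (r, s) hs')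
  refine HasDerivAt.congr_of_eventuallyEq ?_ heq
  refine hasDerivAt_pi.2 fun j => ?_
  have h := (hasDerivAt_blowUp_right r θ).mul
    ((hV j _ (hs _ hp)).deriv.differentiableAt.hasDerivAt.comp_of_eq θ
      (hasDerivAt_blowUp_right r θ) rfl)
  refine ((Complex.reCLM.hasFDerivAt.comp_hasDerivAt θ h).const_add _).congr_deriv ?_
  simp only [Complex.reCLM_apply, Function.comp_apply]
  have : ∀ z : ℂ, (Complex.I * z).re = -z.im := fun z => by simp
  rw [← this]
  congr 1
  ring

/-- Laplace's equation in polar coordinates. -/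
theorem polarSweep_laplace (hV : ∀ j, AnalyticOnNhd ℂ (J j) V)
    (hs : ∀ p ∈ strip, blowUp p ∈ V) {r θ : ℝ} (hp : (r, θ) ∈ strip) :
    r ^ 2 • partial1 (partial1 (polarSweep a b J)) (r, θ) +
      partial2 (partial2 (polarSweep a b J)) (r, θ) =
        -(r • partial1 (polarSweep a b J) (r, θ)) := by
  rw [partial1_partial1_polarSweep hV hs hp, partial2_partial2_polarSweep hV hs hp,
    partial1_polarSweep fun j => hV j _ (hs _ hp)]
  funext j
  simp only [Pi.add_apply, Pi.smul_apply, Pi.neg_apply, smul_eq_mul]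
  rw [← Complex.im_ofReal_mul, ← Complex.im_ofReal_mul, ← Complex.neg_im, ← Complex.add_im,
    ← Complex.neg_im]
  congr 1
  simp only [blowUp]
  push_cast
  ring

/-- Conformality turns the left side into `⟨S_r, S_r⟩ det(S_r, S_θ, r² S_rr + S_θθ)`. By Laplace's
equation the last entry is a multiple of `S_r`, so no nondegeneracy is needed. -/
theorem hasZeroMeanCurvatureAt_of_polar {S : ℝ × ℝ → L3} {r θ : ℝ}
    (hlap : r ^ 2 • partial1 (partial1 S) (r, θ) + partial2 (partial2 S) (r, θ) =
      -(r • partial1 S (r, θ)))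
    (h1 : lorentz (partial2 S (r, θ)) (partial2 S (r, θ)) =
      r ^ 2 * lorentz (partial1 S (r, θ)) (partial1 S (r, θ)))
    (h2 : lorentz (partial1 S (r, θ)) (partial2 S (r, θ)) = 0) :
    HasZeroMeanCurvatureAt S (r, θ) := by
  unfold HasZeroMeanCurvatureAt
  have h3 : partial2 (partial2 S) (r, θ) =
      -(r • partial1 S (r, θ)) - r ^ 2 • partial1 (partial1 S) (r, θ) :=
    eq_sub_of_add_eq' hlap
  rw [h1, h2, h3]
  simp only [det3, Matrix.det_fin_three, Matrix.of_apply, Matrix.cons_val_zero,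
    Matrix.cons_val_one, Matrix.cons_val, Pi.sub_apply, Pi.neg_apply, Pi.smul_apply, smul_eq_mul]
  ring

end PolarSweep

/-! ### Critical points of real holomorphic functions and the Gauss map of a null curve. -/

open Filter Topology

theorem exists_pow_smul_of_analyticAt_of_deriv_eq_zero {g : ℂ → ℂ} (hg : AnalyticAt ℂ g 0)
    (h0 : g 0 = 0) (h1 : deriv g 0 = 0) (hne : ¬∀ᶠ z in 𝓝 0, g z = 0) :
    ∃ m : ℕ, 2 ≤ m ∧ ∃ h : ℂ → ℂ, AnalyticAt ℂ h 0 ∧ h 0 ≠ 0 ∧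
      ∀ᶠ z in 𝓝 0, g z = z ^ m * h z := by
  obtain ⟨m, h, hh, hh0, hgh⟩ := hg.exists_eventuallyEq_pow_smul_nonzero_iff.2 hne
  simp only [sub_zero, smul_eq_mul] at hgh
  refine ⟨m, ?_, h, hh, hh0, hgh⟩
  by_contra hm
  interval_cases m
  · exact hh0 (by simpa [h0] using hgh.self_of_nhds.symm)
  · have hd : HasDerivAt g (h 0) 0 := by
      have := (hasDerivAt_id (0 : ℂ)).mul hh.differentiableAt.hasDerivAt
      refine (this.congr_deriv (by simp)).congr_of_eventuallyEq ?_
      filter_upwards [hgh] with z hz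
      simpa using hz
    exact hh0 (hd.deriv ▸ h1)

/-- A holomorphic function, real on the real axis and vanishing to order at least two at `0`,
takes real values in every upper half disk around `0`. -/
theorem frequently_im_eq_zero_of_deriv_eq_zero {g : ℂ → ℂ} (hg : AnalyticAt ℂ g 0)
    (hreal : ∀ᶠ x : ℝ in 𝓝 0, (g x).im = 0) (h0 : g 0 = 0) (h1 : deriv g 0 = 0) :
    ¬∀ᶠ z in 𝓝 (0 : ℂ), 0 < z.im → (g z).im ≠ 0 := by
  intro hne
  have hpi := Real.pi_pos
  by_cases hz : ∀ᶠ z in 𝓝 0, g z = 0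
  · obtain ⟨ρ, hρ, hb⟩ := Metric.eventually_nhds_iff.1 (hz.and hne)
    have := hb (y := (ρ / 2 : ℝ) * Complex.I) (by
      rw [dist_zero_right, norm_mul, Complex.norm_I, Complex.norm_real,
        Real.norm_of_nonneg (by positivity)]
      linarith)
    exact this.2 (by simpa using hρ) (by rw [this.1]; rfl)
  obtain ⟨m, hm, h, hh, hh0, hgh⟩ :=
    exists_pow_smul_of_analyticAt_of_deriv_eq_zero hg h0 h1 hz
  have hcoe : Tendsto (fun x : ℝ => (x : ℂ)) (𝓝[≠] 0) (𝓝 0) :=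
    (Complex.continuous_ofReal.tendsto' 0 0 (by simp)).mono_left nhdsWithin_le_nhds
  -- On the real axis `h = g / x ^ m` is real; pass to the limit.
  have him : (h 0).im = 0 := by
    have ht : Tendsto (fun x : ℝ => (h x).im) (𝓝[≠] 0) (𝓝 (h 0).im) :=
      (Complex.continuous_im.tendsto _).comp (hh.continuousAt.tendsto.comp hcoe)
    refine tendsto_nhds_unique (ht.congr' ?_) tendsto_const_nhds
    filter_upwards [hcoe.eventually hgh, nhdsWithin_le_nhds hreal, self_mem_nhdsWithin]
      with x hx hx' hx0
    rw [hx, ← Complex.ofReal_pow, Complex.im_ofReal_mul] at hx'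
    exact (mul_eq_zero.1 hx').resolve_left (pow_ne_zero _ hx0)
  have hre : (h 0).re ≠ 0 := fun hre => hh0 (Complex.ext hre him)
  have hsign : ∀ᶠ z in 𝓝 (0 : ℂ), 0 < (h z).re * (h 0).re := by
    have : ContinuousAt (fun z => (h z).re * (h 0).re) 0 :=
      (Complex.continuous_re.continuousAt.comp hh.continuousAt).mul continuousAt_const
    exact this.eventually_const_lt (mul_self_pos.2 hre)
  obtain ⟨ρ, hρ, hb⟩ := Metric.eventually_nhds_iff.1
    (hne.and (hgh.and (hsign.and hg.eventually_analyticAt)))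
  set r := ρ / 2 with hr
  have hr0 : 0 < r := by positivity
  let z : ℝ → ℂ := fun θ => r * Complex.exp (θ * Complex.I)
  have hzn : ∀ θ, dist (z θ) 0 < ρ := fun θ => by
    rw [dist_zero_right, norm_mul, Complex.norm_exp_ofReal_mul_I, Complex.norm_real,
      Real.norm_of_nonneg hr0.le]
    linarith
  have hm0 : (0 : ℝ) < m := by exact_mod_cast (by omega : 0 < m)
  have hm2 : (2 : ℝ) ≤ m := by exact_mod_cast hm
  have hpow : ∀ φ : ℝ, (z (φ / m)) ^ m = (r ^ m : ℝ) * Complex.exp (φ * Complex.I) := by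
    intro φ
    simp only [z]
    rw [mul_pow, ← Complex.exp_nat_mul]
    congr 2
    · push_cast; rfl
    · push_cast
      have : (m : ℂ) ≠ 0 := by exact_mod_cast hm0.ne'
      field_simp
  have hcont : Continuous fun θ => (g (z θ)).im := by
    rw [continuous_iff_continuousAt]
    intro θ
    refine Complex.continuous_im.continuousAt.comp
      (ContinuousAt.comp (hb (hzn θ)).2.2.2.continuousAt ?_)
    exact Continuous.continuousAt (by fun_prop)
  -- At the angles `π/(2m)` and `3π/(2m)` the factor `z ^ m` is `± i r ^ m`, so `Im g` has opposite
  -- signs and vanishes in between. Both angles lie in `(0, π)` because `m ≥ 2`.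
  have hα : (g (z (Real.pi / 2 / m))).im = r ^ m * (h (z (Real.pi / 2 / m))).re := by
    rw [(hb (hzn _)).2.1, hpow, mul_assoc, Complex.im_ofReal_mul]
    push_cast
    rw [Complex.exp_pi_div_two_mul_I]
    simp
  have hβ : (g (z ((Real.pi + Real.pi / 2) / m))).im =
      -(r ^ m * (h (z ((Real.pi + Real.pi / 2) / m))).re) := by
    rw [(hb (hzn _)).2.1, hpow, mul_assoc, Complex.im_ofReal_mul]
    push_cast
    rw [add_mul, Complex.exp_add, Complex.exp_pi_div_two_mul_I, Complex.exp_pi_mul_I]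
    simp
  have hrm : 0 < r ^ m := by positivity
  have hsα := (hb (hzn (Real.pi / 2 / m))).2.2.1
  have hsβ := (hb (hzn ((Real.pi + Real.pi / 2) / m))).2.2.1
  have hmem : (0 : ℝ) ∈ Set.uIcc (g (z (Real.pi / 2 / m))).im
      (g (z ((Real.pi + Real.pi / 2) / m))).im := by
    rw [hα, hβ, Set.mem_uIcc]
    rcases lt_or_gt_of_ne hre with hneg | hpos
    · have h2 : (h (z (Real.pi / 2 / m))).re < 0 := by nlinarith
      have h3 : (h (z ((Real.pi + Real.pi / 2) / m))).re < 0 := by nlinarith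
      left
      constructor <;> nlinarith
    · have h2 : 0 < (h (z (Real.pi / 2 / m))).re := by nlinarith
      have h3 : 0 < (h (z ((Real.pi + Real.pi / 2) / m))).re := by nlinarith
      right
      constructor <;> nlinarith
  obtain ⟨θ, hθ, hθ0⟩ := intermediate_value_uIcc hcont.continuousOn hmem
  have hle : Real.pi / 2 / m ≤ (Real.pi + Real.pi / 2) / m := by gcongr; linarith
  rw [Set.uIcc_of_le hle] at hθ
  refine (hb (hzn θ)).1 ?_ hθ0
  have h5 : 0 < θ := lt_of_lt_of_le (by positivity) hθ.1
  have h6 : θ < Real.pi := by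
    refine lt_of_le_of_lt hθ.2 ?_
    rw [div_lt_iff₀ hm0]
    nlinarith
  have : (z θ).im = r * Real.sin θ := by simp [z, Complex.exp_ofReal_mul_I_im]
  rw [this]
  exact mul_pos hr0 (Real.sin_pos_of_pos_of_lt_pi h5 h6)

/-- A holomorphic null curve through a real null vector `n`, real on the real axis and with
positive Hermitian norm in the upper half plane, has velocity not parallel to `n` at `0`. The
quotient `s / p` below is its Gauss map. -/
theorem deriv_nullCurve_not_parallel {A : Fin 3 → ℂ → ℂ} {n : L3} (hn : IsLightlike n)
    (hA : ∀ j, AnalyticAt ℂ (A j) 0) (hA0 : ∀ j, A j 0 = n j)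
    (hreal : ∀ j, ∀ᶠ x : ℝ in 𝓝 0, (A j x).im = 0)
    (hnull : ∀ᶠ z in 𝓝 (0 : ℂ), 0 < z.im → A 0 z ^ 2 + A 1 z ^ 2 - A 2 z ^ 2 = 0)
    (hpos : ∀ᶠ z in 𝓝 (0 : ℂ), 0 < z.im →
      0 < Complex.normSq (A 0 z) + Complex.normSq (A 1 z) - Complex.normSq (A 2 z))
    (κ : ℝ) : ¬∀ j, deriv (A j) 0 = κ * n j := by
  intro hpar
  obtain ⟨hn0, hnn⟩ := hn
  unfold lorentz at hnn
  have hn2 : n 2 ≠ 0 := by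
    intro h2
    rw [h2] at hnn
    have h0 : n 0 = 0 := by nlinarith [sq_nonneg (n 0), sq_nonneg (n 1)]
    have h1 : n 1 = 0 := by nlinarith [sq_nonneg (n 0), sq_nonneg (n 1)]
    refine hn0 (funext fun j => ?_)
    fin_cases j <;> simp [h0, h1, h2]
  obtain ⟨e₀, he₀⟩ : ∃ e, e = n 0 / n 2 := ⟨_, rfl⟩
  obtain ⟨e₁, he₁⟩ : ∃ e, e = n 1 / n 2 := ⟨_, rfl⟩
  have hn0' : n 0 = e₀ * n 2 := by rw [he₀]; field_simp
  have hn1' : n 1 = e₁ * n 2 := by rw [he₁]; field_simp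
  have he : e₀ ^ 2 + e₁ ^ 2 = 1 := by
    rw [he₀, he₁]; field_simp; linarith
  have heC : (e₀ : ℂ) ^ 2 + (e₁ : ℂ) ^ 2 = 1 := by exact_mod_cast he
  -- Coordinates adapted to the null direction `(e₀, e₁, 1)` of `n`: with `q` below, the quadratic
  -- form is `s² - p q`, and `s` vanishes exactly along the real plane containing `n` and the time
  -- axis.
  let p : ℂ → ℂ := fun z => A 2 z + (e₀ * A 0 z + e₁ * A 1 z)
  let s : ℂ → ℂ := fun z => e₀ * A 1 z - e₁ * A 0 z
  have hp : AnalyticAt ℂ p 0 :=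
    (hA 2).add ((analyticAt_const.mul (hA 0)).add (analyticAt_const.mul (hA 1)))
  have hs : AnalyticAt ℂ s 0 :=
    (analyticAt_const.mul (hA 1)).sub (analyticAt_const.mul (hA 0))
  have hp0 : p 0 ≠ 0 := by
    have : p 0 = ((2 * n 2 : ℝ) : ℂ) := by
      simp only [p, hA0]
      norm_cast
      rw [hn0', hn1']
      linear_combination n 2 * he
    rw [this]
    exact_mod_cast mul_ne_zero two_ne_zero hn2
  have hs0 : s 0 = 0 := by
    simp only [s, hA0, hn0', hn1']
    push_cast
    ring
  have hds : deriv s 0 = 0 := by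
    have h1 := (((hA 1).differentiableAt.hasDerivAt).const_mul (e₀ : ℂ)).sub
      (((hA 0).differentiableAt.hasDerivAt).const_mul (e₁ : ℂ))
    refine (HasDerivAt.deriv h1).trans ?_
    rw [hpar, hpar, hn0', hn1']
    push_cast
    ring
  have hg : AnalyticAt ℂ (fun z => s z / p z) 0 := hs.div hp hp0
  refine frequently_im_eq_zero_of_deriv_eq_zero hg ?_ (by simp [hs0]) ?_ ?_
  · filter_upwards [hreal 0, hreal 1, hreal 2] with x h0 h1 h2
    have h3 : (s x).im = 0 := by simp [s, h0, h1]
    have h4 : (p x).im = 0 := by simp [p, h0, h1, h2]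
    simp [Complex.div_im, h3, h4]
  · have := hs.differentiableAt.hasDerivAt.div hp.differentiableAt.hasDerivAt hp0
    refine (HasDerivAt.deriv this).trans ?_
    simp [hs0, hds]
  · filter_upwards [hnull, hpos, hp.continuousAt.eventually_ne hp0] with z h1 h2 h3 hz hg0
    have h1 := h1 hz
    have h2 := h2 hz
    obtain ⟨x, hx⟩ : ∃ x : ℝ, s z / p z = x :=
      ⟨(s z / p z).re, Complex.ext rfl (by simpa using hg0)⟩
    have hsx : s z = x * p z := by rw [← hx]; field_simp
    obtain ⟨q, hq⟩ : ∃ q, q = A 2 z - (e₀ * A 0 z + e₁ * A 1 z) := ⟨_, rfl⟩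
    have hpq : p z * q = s z ^ 2 := by
      simp only [p, s, hq]
      linear_combination -h1 - (A 0 z ^ 2 + A 1 z ^ 2) * heC
    have hqx : q = ((x ^ 2 : ℝ) : ℂ) * p z := by
      refine mul_left_cancel₀ h3 ?_
      rw [hpq, hsx]
      push_cast
      ring
    -- The Hermitian form is `|s|² - Re (p q̄)`; for real `x`, `s = x p` and `q = x² p` make it
    -- zero.
    have hherm : Complex.normSq (A 0 z) + Complex.normSq (A 1 z) - Complex.normSq (A 2 z) =
        ((s z).re ^ 2 + (s z).im ^ 2) - ((p z).re * q.re + (p z).im * q.im) := by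
      simp only [s, p, hq, Complex.normSq_apply, Complex.sub_re, Complex.sub_im, Complex.add_re,
        Complex.add_im, Complex.re_ofReal_mul, Complex.im_ofReal_mul]
      linear_combination -((A 0 z).re ^ 2 + (A 0 z).im ^ 2 + (A 1 z).re ^ 2 + (A 1 z).im ^ 2) * he
    rw [hherm, hsx, hqx] at h2
    simp only [Complex.re_ofReal_mul, Complex.im_ofReal_mul] at h2
    nlinarith

/-! ### Coordinate changes and conformality for `r ≠ 0`. -/

theorem I_add_ne_zero {ζ : ℂ} (hζ : 0 < ζ.im) : Complex.I + ζ ≠ 0 := fun h => by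
  have := congrArg Complex.im h
  simp at this
  linarith

theorem bijOn_cayley (w₀ : Circle) :
    Set.BijOn (cayley w₀) {ζ | 0 < ζ.im} (Metric.ball (0 : ℂ) 1) := by
  refine ⟨fun ζ hζ => ?_, fun ζ hζ ξ hξ h => ?_, fun w hw => ?_⟩
  · have hN : 0 < ‖Complex.I + ζ‖ := norm_pos_iff.2 (I_add_ne_zero hζ)
    rw [mem_ball_zero_iff, cayley, norm_mul, norm_div, Circle.norm_coe, one_mul, div_lt_one hN]
    refine lt_of_pow_lt_pow_left₀ 2 hN.le ?_
    rw [← Complex.normSq_eq_norm_sq, ← Complex.normSq_eq_norm_sq, Complex.normSq_apply,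
      Complex.normSq_apply]
    have : 0 < ζ.im := hζ
    simp
    nlinarith
  · have h1 := I_add_ne_zero hζ
    have h2 := I_add_ne_zero hξ
    have h3 := mul_left_cancel₀ w₀.coe_ne_zero h
    rw [div_eq_div_iff h1 h2] at h3
    have h4 : 2 * Complex.I * (ζ - ξ) = 0 := by linear_combination -h3
    exact sub_eq_zero.1 ((mul_eq_zero.1 h4).resolve_left (by simp))
  · obtain ⟨u, hu⟩ : ∃ u, u = w / w₀ := ⟨_, rfl⟩
    have hw0 := w₀.coe_ne_zero
    have hwu : w = w₀ * u := by rw [hu]; field_simp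
    have hun : ‖u‖ < 1 := by
      rw [hu, norm_div, Circle.norm_coe, div_one]
      exact mem_ball_zero_iff.1 hw
    have h1 : 1 + u ≠ 0 := fun h => by
      have : u = -1 := by linear_combination h
      rw [this, norm_neg, norm_one] at hun
      exact lt_irrefl _ hun
    refine ⟨Complex.I * (1 - u) / (1 + u), ?_, ?_⟩
    · have h2 : (Complex.I * (1 - u) / (1 + u)).im = (1 - ‖u‖ ^ 2) / Complex.normSq (1 + u) := by
        rw [Complex.div_im, ← sub_div]
        congr 1
        rw [← Complex.normSq_eq_norm_sq, Complex.normSq_apply]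
        simp
        ring
      change 0 < (Complex.I * (1 - u) / (1 + u)).im
      rw [h2]
      exact div_pos (by nlinarith [norm_nonneg u]) (Complex.normSq_pos.2 h1)
    · rw [cayley, hwu]
      congr 1
      have hI : Complex.I ≠ 0 := Complex.I_ne_zero
      have h3 : Complex.I + Complex.I * (1 - u) / (1 + u) = 2 * Complex.I / (1 + u) := by
        field_simp
        ring
      rw [h3]
      field_simp
      ring

theorem bijOn_blowUp : Set.BijOn blowUp halfStrip {ζ : ℂ | 0 < ζ.im} := by
  have hn : ∀ r θ : ℝ, 0 < r → ‖blowUp (r, θ)‖ = r := fun r θ hr => by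
    simp [blowUp, Complex.norm_exp_ofReal_mul_I, abs_of_pos hr]
  refine ⟨fun p hp => ?_, fun p hp q hq h => ?_, fun ζ hζ => ⟨(‖ζ‖, ζ.arg), ?_, ?_⟩⟩
  · change 0 < (blowUp (p.1, p.2)).im
    rw [blowUp_im]
    exact mul_pos hp.1 (Real.sin_pos_of_pos_of_lt_pi hp.2.1 hp.2.2)
  · refine Prod.ext ?_ ?_
    · rw [← hn p.1 p.2 hp.1, ← hn q.1 q.2 hq.1]
      exact congrArg norm h
    · rw [← arg_blowUp hp.1 hp.2.1 hp.2.2, ← arg_blowUp hq.1 hq.2.1 hq.2.2]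
      exact congrArg Complex.arg h
  · have h0 : ζ ≠ 0 := fun h => by simp [h] at hζ
    have him : 0 < ζ.im := hζ
    have harg0 : ζ.arg ≠ 0 := fun h => him.ne' (Complex.arg_eq_zero_iff.1 h).2
    have hargpi : ζ.arg ≠ Real.pi := fun h => him.ne' (Complex.arg_eq_pi_iff.1 h).2
    exact ⟨norm_pos_iff.2 h0, lt_of_le_of_ne (Complex.arg_nonneg_iff.2 him.le) (Ne.symm harg0),
      lt_of_le_of_ne (Complex.arg_le_pi ζ) hargpi⟩
  · exact Complex.norm_mul_exp_arg_mul_I ζ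

theorem blowUp_reflect (r θ : ℝ) :
    blowUp (-r, Real.pi - θ) = starRingEnd ℂ (blowUp (r, θ)) := by
  apply Complex.ext <;> simp [blowUp_re, blowUp_im]

theorem hasDerivAt_cayley (w₀ : Circle) {ζ : ℂ} (hζ : 0 < ζ.im) :
    ∃ c ≠ 0, HasDerivAt (cayley w₀) c ζ := by
  have hne := I_add_ne_zero hζ
  have h := (((hasDerivAt_id ζ).const_sub Complex.I).div
    ((hasDerivAt_id ζ).const_add Complex.I) hne).const_mul (w₀ : ℂ)
  refine ⟨_, ?_, h⟩
  refine mul_ne_zero w₀.coe_ne_zero (div_ne_zero ?_ (pow_ne_zero _ hne))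
  simp only [id]
  intro h0
  have : 2 * Complex.I = 0 := by linear_combination -h0
  simp at this

theorem lorentz_smul_add_smul (x y : L3) (s t s' t' : ℝ) :
    lorentz (s • x + t • y) (s' • x + t' • y) =
      s * s' * lorentz x x + (s * t' + t * s') * lorentz x y + t * t' * lorentz y y := by
  simp only [lorentz, Pi.add_apply, Pi.smul_apply, smul_eq_mul]
  ring

theorem IsIsothermalParametrization.lorentz_fderiv {X : ℂ → L3} {S : Set L3}
    (hX : IsIsothermalParametrization X S) {w : ℂ} (hw : w ∈ Metric.ball (0 : ℂ) 1) (z z' : ℂ) :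
    lorentz (fderiv ℝ X w z) (fderiv ℝ X w z') =
      (z.re * z'.re + z.im * z'.im) * lorentz (fderiv ℝ X w 1) (fderiv ℝ X w 1) := by
  have h : ∀ z : ℂ, fderiv ℝ X w z = z.re • fderiv ℝ X w 1 + z.im • fderiv ℝ X w Complex.I := by
    intro z
    rw [← map_smul, ← map_smul, ← map_add]
    congr 1
    simp
  rw [h z, h z', lorentz_smul_add_smul, hX.orthogonal w hw, ← hX.eq_norm w hw]
  ring

theorem fderiv_eq_smul_partial (S : ℝ × ℝ → L3) (p v : ℝ × ℝ) :
    fderiv ℝ S p v = v.1 • partial1 S p + v.2 • partial2 S p := by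
  rw [partial1, partial2, ← map_smul, ← map_smul, ← map_add]
  congr 1
  simp

/-- Conformality in polar coordinates. -/
def IsPolarConformalAt (S : ℝ × ℝ → L3) (p : ℝ × ℝ) : Prop :=
  0 < lorentz (partial1 S p) (partial1 S p) ∧
    lorentz (partial2 S p) (partial2 S p) = p.1 ^ 2 * lorentz (partial1 S p) (partial1 S p) ∧
    lorentz (partial1 S p) (partial2 S p) = 0

theorem IsPolarConformalAt.isSpacelikeAt {S : ℝ × ℝ → L3} {p : ℝ × ℝ}
    (h : IsPolarConformalAt S p) (hp : p.1 ≠ 0) : IsSpacelikeAt S p := by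
  intro v hv
  obtain ⟨h1, h2, h3⟩ := h
  rw [fderiv_eq_smul_partial, lorentz_smul_add_smul, h2, h3]
  have h4 : 0 < v.1 ^ 2 + (v.2 * p.1) ^ 2 := by
    by_cases hv1 : v.1 = 0
    · have hv2 : v.2 ≠ 0 := fun hv2 => hv (Prod.ext hv1 hv2)
      have := mul_ne_zero hv2 hp
      positivity
    · positivity
  calc 0 < (v.1 ^ 2 + (v.2 * p.1) ^ 2) * lorentz (partial1 S p) (partial1 S p) := mul_pos h4 h1
    _ = _ := by ring

theorem IsSpacelikeAt.injective_fderiv {S : ℝ × ℝ → L3} {p : ℝ × ℝ} (h : IsSpacelikeAt S p) :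
    Function.Injective (fderiv ℝ S p) := by
  rw [injective_iff_map_eq_zero]
  intro v hv
  by_contra hne
  have := h v hne
  simp [hv, lorentz] at this

theorem isOpen_halfStrip : IsOpen halfStrip :=
  (isOpen_lt continuous_const continuous_fst).inter
    ((isOpen_lt continuous_const continuous_snd).inter (isOpen_lt continuous_snd continuous_const))

/-- The Cayley map is holomorphic, so the two polar directions are sent to `u` and `r i u` for one
nonzero complex `u`; an isothermal `X` preserves their angle and length ratio. -/
theorem isPolarConformalAt_of_isothermal {X : ℂ → L3} {S : Set L3}
    (hX : IsIsothermalParametrization X S) {w₀ : Circle} {F : ℝ × ℝ → L3}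
    (hF : ∀ p ∈ halfStrip, F p = X (cayley w₀ (blowUp p))) {p : ℝ × ℝ} (hp : p ∈ halfStrip)
    (hd : DifferentiableAt ℝ F p) : IsPolarConformalAt F p := by
  obtain ⟨r, θ⟩ := p
  have hζ : 0 < (blowUp (r, θ)).im := bijOn_blowUp.mapsTo hp
  have hw := (bijOn_cayley w₀).mapsTo hζ
  obtain ⟨c, hc, hcd⟩ := hasDerivAt_cayley w₀ hζ
  have hXd : HasFDerivAt X (fderiv ℝ X (cayley w₀ (blowUp (r, θ)))) (cayley w₀ (blowUp (r, θ))) :=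
    ((hX.smooth.contDiffAt (Metric.isOpen_ball.mem_nhds hw)).differentiableAt
      (by simp)).hasFDerivAt
  have hev : ∀ᶠ p in 𝓝 (r, θ), F p = X (cayley w₀ (blowUp p)) := by
    filter_upwards [isOpen_halfStrip.mem_nhds hp] with p hp using hF p hp
  have h1 : partial1 F (r, θ) =
      fderiv ℝ X (cayley w₀ (blowUp (r, θ))) (c * Complex.exp (θ * Complex.I)) := by
    refine partial1_eq_of_hasDerivAt hd ?_
    refine (hXd.comp_hasDerivAt r (hcd.comp_of_eq r (hasDerivAt_blowUp_left r θ) rfl)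
      ).congr_of_eventuallyEq ?_
    exact (Continuous.tendsto (by fun_prop : Continuous fun s : ℝ => (s, θ)) r).eventually hev
  have h2 : partial2 F (r, θ) =
      fderiv ℝ X (cayley w₀ (blowUp (r, θ))) (c * (Complex.I * blowUp (r, θ))) := by
    refine partial2_eq_of_hasDerivAt hd ?_
    refine (hXd.comp_hasDerivAt θ (hcd.comp_of_eq θ (hasDerivAt_blowUp_right r θ) rfl)
      ).congr_of_eventuallyEq ?_
    exact (Continuous.tendsto (by fun_prop : Continuous fun s : ℝ => (r, s)) θ).eventually hev
  obtain ⟨u, hu⟩ : ∃ u, u = c * Complex.exp (θ * Complex.I) := ⟨_, rfl⟩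
  have hu2 : c * (Complex.I * blowUp (r, θ)) = (r : ℂ) * (Complex.I * u) := by
    rw [hu, blowUp]; ring
  have hu0 : u ≠ 0 := hu ▸ mul_ne_zero hc (Complex.exp_ne_zero _)
  rw [hu2] at h2
  rw [← hu] at h1
  have hun := Complex.normSq_pos.2 hu0
  rw [Complex.normSq_apply] at hun
  refine ⟨?_, ?_, ?_⟩
  · rw [h1, hX.lorentz_fderiv hw]
    exact mul_pos hun (hX.pos _ hw)
  · rw [h1, h2, hX.lorentz_fderiv hw, hX.lorentz_fderiv hw u u]
    simp only [Complex.re_ofReal_mul, Complex.im_ofReal_mul, Complex.I_mul_re, Complex.I_mul_im]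
    ring
  · rw [h1, h2, hX.lorentz_fderiv hw]
    simp only [Complex.re_ofReal_mul, Complex.im_ofReal_mul, Complex.I_mul_re, Complex.I_mul_im]
    ring

/-! ### Symmetry, and the surface along the segment. -/

/-- The sign changes in the argument and in the value cancel, so conformality transfers unchanged to
`r < 0`. -/
theorem fderiv_eq_of_pointSymmetric {F : ℝ × ℝ → L3} {U : Set (ℝ × ℝ)} (hU : IsOpen U) {c : L3}
    {d : ℝ × ℝ} (hF : ∀ p ∈ U, F (d - p) = c - F p) {p : ℝ × ℝ} (hp : p ∈ U)
    (hd : DifferentiableAt ℝ F (d - p)) : fderiv ℝ F (d - p) = fderiv ℝ F p := by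
  have h1 := hd.hasFDerivAt.comp p ((hasFDerivAt_id p).const_sub d)
  have h2 : HasFDerivAt F (fderiv ℝ F (d - p)) p := by
    refine ((h1.const_sub c).congr_fderiv ?_).congr_of_eventuallyEq ?_
    · ext v <;> simp
    · filter_upwards [hU.mem_nhds hp] with x hx
      simp [hF x hx]
  exact h2.fderiv.symm

section Extension

variable {a b : L3} {J : Fin 3 → ℂ → ℂ}

theorem polarSweep_reflect (hconj : ∀ j ζ, J j (starRingEnd ℂ ζ) = starRingEnd ℂ (J j ζ))
    (r θ : ℝ) : polarSweep a b J (-r, Real.pi - θ) = (a + b) - polarSweep a b J (r, θ) := by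
  funext j
  simp only [polarSweep, blowUp_reflect, hconj, Complex.conj_im, Pi.sub_apply, Pi.add_apply]
  field_simp
  ring

theorem polarSweep_zero (hconj : ∀ j ζ, J j (starRingEnd ℂ ζ) = starRingEnd ℂ (J j ζ))
    (θ : ℝ) : polarSweep a b J (0, θ) = AffineMap.lineMap b a (θ / Real.pi) := by
  have h0 : ∀ j, (J j 0).im = 0 := fun j => by
    have := hconj j 0
    rw [map_zero] at this
    exact Complex.conj_eq_iff_im.1 this.symm
  funext j
  simp [polarSweep, AffineMap.lineMap_apply, blowUp, h0]
  ring

theorem deriv_im_eq_zero {f : ℂ → ℂ} (hconj : ∀ ζ, f (starRingEnd ℂ ζ) = starRingEnd ℂ (f ζ))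
    (x : ℝ) : (deriv f x).im = 0 := by
  have h : starRingEnd ℂ ∘ f ∘ starRingEnd ℂ = f := by
    funext ζ
    simp [hconj]
  have h1 := deriv_conj_conj (f := f)
  rw [h] at h1
  have h2 := congrFun h1 x
  simp only [Function.comp_apply, Complex.conj_ofReal] at h2
  exact Complex.conj_eq_iff_im.1 h2.symm

theorem lightlike_smul {v : L3} (hv : IsLightlike v) {c : ℝ} (hc : c ≠ 0) :
    IsLightlike (c • v) := by
  refine ⟨smul_ne_zero hc hv.1, ?_⟩
  have := hv.2
  simp only [lorentz, Pi.smul_apply, smul_eq_mul] at this ⊢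
  linear_combination c ^ 2 * this

/-- The extended surface is immersed along the lightlike segment. -/
theorem polarSweep_injective_fderiv_zero (hab : IsLightlike (a - b))
    (hJ : ∀ᶠ ζ in 𝓝 (0 : ℂ), ∀ j, AnalyticAt ℂ (J j) ζ)
    (hconj : ∀ j ζ, J j (starRingEnd ℂ ζ) = starRingEnd ℂ (J j ζ))
    (hconf : ∀ p ∈ halfStrip, IsPolarConformalAt (polarSweep a b J) p) {θ : ℝ}
    (hθ : θ ∈ Set.Ioo 0 Real.pi) : Function.Injective (fderiv ℝ (polarSweep a b J) (0, θ)) := by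
  have hpi := Real.pi_pos
  have hJ0 := hJ.self_of_nhds
  -- This is `F_θ + i r F_r`; polar conformality says that it is null with positive Hermitian norm.
  let A : Fin 3 → ℂ → ℂ := fun j ζ => ((a j - b j) / Real.pi : ℝ) + ζ * deriv (J j) ζ
  have hAA : ∀ j, AnalyticAt ℂ (A j) 0 := fun j =>
    analyticAt_const.add (analyticAt_id.mul (hJ0 j).deriv)
  have hAd : ∀ j, deriv (A j) 0 = deriv (J j) 0 := fun j => by
    have h := ((hasDerivAt_id (0 : ℂ)).mul (hJ0 j).deriv.differentiableAt.hasDerivAt).const_add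
      (((a j - b j) / Real.pi : ℝ) : ℂ)
    refine (HasDerivAt.deriv h).trans ?_
    simp
  have hpolar : ∀ᶠ ζ in 𝓝 (0 : ℂ), 0 < ζ.im → ∃ r θ : ℝ, (r, θ) ∈ halfStrip ∧ ∀ j,
      (A j ζ).re = partial2 (polarSweep a b J) (r, θ) j ∧
      (A j ζ).im = r * partial1 (polarSweep a b J) (r, θ) j := by
    filter_upwards [hJ] with ζ hζJ hζ
    obtain ⟨⟨r, θ⟩, hp, rfl⟩ := bijOn_blowUp.surjOn hζ
    refine ⟨r, θ, hp, fun j => ?_⟩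
    rw [partial1_polarSweep hζJ, partial2_polarSweep hζJ]
    simp only [A, Complex.add_re, Complex.add_im, Complex.ofReal_re, Complex.ofReal_im, zero_add]
    refine ⟨trivial, ?_⟩
    rw [← Complex.im_ofReal_mul, blowUp]
    congr 1
    ring
  have hnp := deriv_nullCurve_not_parallel (A := A)
    (lightlike_smul hab (inv_ne_zero hpi.ne')) hAA
    (fun j => by simp [A, div_eq_inv_mul])
    (fun j => Eventually.of_forall fun x => by
      simp only [A, Complex.add_im, Complex.ofReal_im, Complex.im_ofReal_mul,
        deriv_im_eq_zero (hconj j), mul_zero, add_zero])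
    (by
      filter_upwards [hpolar] with ζ h hζ
      obtain ⟨r, θ, hp, h⟩ := h hζ
      obtain ⟨-, h2, h3⟩ := hconf _ hp
      unfold lorentz at h2 h3
      apply Complex.ext
      · simp only [pow_two, Complex.sub_re, Complex.add_re, Complex.mul_re, (h _).1, (h _).2,
          Complex.zero_re]
        linear_combination h2
      · simp only [pow_two, Complex.sub_im, Complex.add_im, Complex.mul_im, (h _).1, (h _).2,
          Complex.zero_im]
        linear_combination 2 * r * h3)
    (by
      filter_upwards [hpolar] with ζ h hζ
      obtain ⟨r, θ, hp, h⟩ := h hζ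
      obtain ⟨h1, h2, -⟩ := hconf _ hp
      have h4 := mul_pos (pow_pos hp.1 2) h1
      simp only at h2 h4
      unfold lorentz at h2 h4
      simp only [Complex.normSq_apply, (h _).1, (h _).2]
      linarith)
  rw [injective_iff_map_eq_zero]
  intro v hv
  have hz : blowUp (0, θ) = 0 := by simp [blowUp]
  rw [fderiv_eq_smul_partial, partial1_polarSweep (by rwa [hz]),
    partial2_polarSweep (by rwa [hz]), hz] at hv
  have hsin := Real.sin_pos_of_pos_of_lt_pi hθ.1 hθ.2
  -- At `r = 0` one has `F_r = sin θ · J'(0)`, with `J'(0)` real, and `F_θ = (a - b)/π`. A kernel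
  -- vector with `v.1 ≠ 0` would make `A'(0) = J'(0)` parallel to `A(0)`.
  have hv' : ∀ j, v.1 * ((deriv (J j) 0).re * Real.sin θ) + v.2 * ((a j - b j) / Real.pi) = 0 := by
    intro j
    have h1 := congrFun hv j
    have h2 : (deriv (J j) 0).im = 0 := by simpa using deriv_im_eq_zero (hconj j) 0
    simpa [Complex.mul_im, Complex.exp_ofReal_mul_I_im, h2] using h1
  by_cases hv1 : v.1 = 0
  · refine Prod.ext hv1 ?_
    by_contra hv2
    refine hab.1 (funext fun j => ?_)
    have := hv' j
    rw [hv1, zero_mul, zero_add] at this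
    have h5 := (mul_eq_zero.1 this).resolve_left hv2
    exact (div_eq_zero_iff.1 h5).resolve_right hpi.ne'
  · refine absurd (fun j => ?_) (hnp (-(v.2 / (v.1 * Real.sin θ))))
    rw [hAd]
    have h2 : (deriv (J j) 0).im = 0 := by simpa using deriv_im_eq_zero (hconj j) 0
    apply Complex.ext
    · have := hv' j
      rw [← Complex.ofReal_mul, Complex.ofReal_re, Pi.smul_apply, Pi.sub_apply, smul_eq_mul]
      field_simp
      field_simp at this
      linarith
    · rw [← Complex.ofReal_mul, Complex.ofReal_im, h2]

end Extension

/-- The strict positivity need not survive the limit `r → 0`, but the two identities do, and the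
mean curvature equation needs only those. -/
theorem IsPolarConformalAt.of_ne_zero_of_continuous {S : ℝ × ℝ → L3} {θ : ℝ}
    (h1 : ContinuousAt (fun r => partial1 S (r, θ)) 0)
    (h2 : ContinuousAt (fun r => partial2 S (r, θ)) 0)
    (h : ∀ r ≠ 0, IsPolarConformalAt S (r, θ)) :
    lorentz (partial2 S (0, θ)) (partial2 S (0, θ)) = 0 ∧
      lorentz (partial1 S (0, θ)) (partial2 S (0, θ)) = 0 := by
  have hcomp : ∀ {f : ℝ → L3}, ContinuousAt f 0 → ∀ j, ContinuousAt (fun r => f r j) 0 :=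
    fun hf j => (continuous_apply j).continuousAt.comp hf
  have hlor : ∀ {f g : ℝ → L3}, ContinuousAt f 0 → ContinuousAt g 0 →
      ContinuousAt (fun r => lorentz (f r) (g r)) 0 := fun hf hg =>
    (((hcomp hf 0).mul (hcomp hg 0)).add ((hcomp hf 1).mul (hcomp hg 1))).sub
      ((hcomp hf 2).mul (hcomp hg 2))
  constructor
  · have hl : Tendsto (fun r => lorentz (partial2 S (r, θ)) (partial2 S (r, θ)) -
        r ^ 2 * lorentz (partial1 S (r, θ)) (partial1 S (r, θ))) (𝓝[≠] 0) (𝓝 _) :=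
      (((hlor h2 h2).sub ((continuousAt_id.pow 2).mul (hlor h1 h1))).tendsto).mono_left
        nhdsWithin_le_nhds
    have h0 := tendsto_nhds_unique (hl.congr' (f₂ := fun _ => (0 : ℝ)) (by
      filter_upwards [self_mem_nhdsWithin] with r hr
      rw [(h r hr).2.1, sub_self])) tendsto_const_nhds
    simpa using h0
  · have hl : Tendsto (fun r => lorentz (partial1 S (r, θ)) (partial2 S (r, θ))) (𝓝[≠] 0) (𝓝 _) :=
      (hlor h1 h2).tendsto.mono_left nhdsWithin_le_nhds
    exact tendsto_nhds_unique (hl.congr' (f₂ := fun _ => (0 : ℝ)) (by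
      filter_upwards [self_mem_nhdsWithin] with r hr using (h r hr).2.2)) tendsto_const_nhds

/-! ### The extension theorem. -/

theorem theorem2p1 (Ω : Set (ℝ × ℝ)) (ψ : ℝ × ℝ → ℝ)
    (hΩ : IsJordanDomain Ω) (hψ : IsMaximalGraph Ω ψ)
    (a b : L3) (hab : IsLightlike (b - a))
    (hL : segment ℝ a b ⊆ graphBoundary Ω ψ)
    (X : ℂ → L3) (hX : IsIsothermalParametrization X (graphSet Ω ψ))
    (w₀ : Circle) (hsing : HasShrinkingSingularitiesAt X w₀ a b) :
    ∃ F : ℝ × ℝ → L3,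
      -- `F` is a real analytic immersion of the whole strip with zero mean curvature
      AnalyticOnNhd ℝ F strip ∧
      (∀ p ∈ strip, Function.Injective (fderiv ℝ F p)) ∧
      (∀ p ∈ strip, HasZeroMeanCurvatureAt F p) ∧
      -- it extends the blow-up reparametrization of the given surface
      (∀ p ∈ halfStrip, F p = X (cayley w₀ (blowUp p))) ∧
      Set.BijOn F halfStrip (graphSet Ω ψ) ∧
      -- across the lightlike segment
      Set.BijOn (fun θ : ℝ => F (0, θ)) (Set.Ioo 0 Real.pi) (openSegment ℝ a b) ∧
      -- it is invariant under the point symmetry at the midpoint of the segment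
      (∀ r θ : ℝ, (r, θ) ∈ strip →
        F (-r, Real.pi - θ) = AffineEquiv.pointReflection ℝ (midpoint ℝ a b) (F (r, θ))) ∧
      AffineEquiv.pointReflection ℝ (midpoint ℝ a b) '' (F '' strip) = F '' strip ∧
      -- it is maximal away from the segment
      (∀ p ∈ strip, p.1 ≠ 0 → F p ∉ segment ℝ a b ∧ IsMaximalAt F p) := by
  have hpi := Real.pi_pos
  obtain ⟨J, ρ, hρ, hJd, hconj, hrep⟩ :=
    exists_herglotz_representation (fun ζ hζ => (bijOn_cayley w₀).mapsTo hζ) hsing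
  let V : Set ℂ := {ζ | ζ.im ≠ 0 ∨ ‖ζ‖ < ρ}
  have hVo : IsOpen V :=
    (isOpen_ne_fun Complex.continuous_im continuous_const).union
      (isOpen_lt continuous_norm continuous_const)
  have hV : ∀ j, AnalyticOnNhd ℂ (J j) V := fun j =>
    DifferentiableOn.analyticOnNhd (fun ζ hζ => (hJd j ζ hζ).differentiableWithinAt) hVo
  have h0V : (0 : ℂ) ∈ V := Or.inr (by simpa using hρ)
  have hs : ∀ p ∈ strip, blowUp p ∈ V := by
    rintro ⟨r, θ⟩ hp
    by_cases hr : r = 0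
    · subst hr
      have : blowUp (0, θ) = 0 := by simp [blowUp]
      rwa [this]
    · left
      rw [blowUp_im]
      exact mul_ne_zero hr (Real.sin_pos_of_pos_of_lt_pi hp.1 hp.2).ne'
  let F := polarSweep a b J
  have hFa : AnalyticOnNhd ℝ F strip := fun p hp =>
    analyticAt_polarSweep fun j => hV j _ (hs p hp)
  have hsub : halfStrip ⊆ strip := fun p hp => hp.2
  have hFX : ∀ p ∈ halfStrip, F p = X (cayley w₀ (blowUp p)) := by
    rintro ⟨r, θ⟩ hp
    exact funext fun j => (hrep j r θ hp.1 hp.2.1 hp.2.2).symm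
  have hbij : Set.BijOn F halfStrip (graphSet Ω ψ) :=
    (hX.bijOn.comp ((bijOn_cayley w₀).comp bijOn_blowUp)).congr fun p hp => (hFX p hp).symm
  have hrefl : ∀ p : ℝ × ℝ, F ((0, Real.pi) - p) = (a + b) - F p := fun p => by
    have := polarSweep_reflect (a := a) (b := b) hconj p.1 p.2
    rwa [← zero_sub p.1] at this
  have hσ : ∀ p ∈ strip, (0, Real.pi) - p ∈ strip := fun p hp =>
    ⟨by simpa using hp.2, by simpa using hp.1⟩
  have hσhalf : ∀ p ∈ strip, p.1 < 0 → (0, Real.pi) - p ∈ halfStrip := fun p hp hp1 =>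
    ⟨by simpa using hp1, hσ p hp⟩
  have hpos : ∀ p ∈ halfStrip, IsPolarConformalAt F p := fun p hp =>
    isPolarConformalAt_of_isothermal hX hFX hp (hFa p (hsub hp)).differentiableAt
  have hconf : ∀ p ∈ strip, p.1 ≠ 0 → IsPolarConformalAt F p := by
    intro p hp hp1
    rcases lt_or_gt_of_ne hp1 with hneg | hpos'
    · have h1 := hpos _ (hσhalf p hp hneg)
      have h2 := fderiv_eq_of_pointSymmetric isOpen_strip (fun p _ => hrefl p) hp
        (hFa _ (hσ p hp)).differentiableAt
      simpa only [IsPolarConformalAt, partial1, partial2, h2, Prod.fst_sub, zero_sub, neg_sq]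
        using h1
    · exact hpos p ⟨hpos', hp⟩
  have hzmc : ∀ p ∈ strip, HasZeroMeanCurvatureAt F p := by
    rintro ⟨r, θ⟩ hp
    have hlap := polarSweep_laplace (a := a) (b := b) hV hs hp
    by_cases hr : r = 0
    · subst hr
      have hcont : ContinuousAt (fun r : ℝ => fderiv ℝ F (r, θ)) 0 :=
        ContinuousAt.comp (f := fun r : ℝ => (r, θ)) (hFa _ hp).fderiv.continuousAt
          (Continuous.continuousAt (by fun_prop))
      have h := IsPolarConformalAt.of_ne_zero_of_continuous
        (hcont.clm_apply continuousAt_const) (hcont.clm_apply continuousAt_const)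
        fun r hr => hconf (r, θ) hp hr
      exact hasZeroMeanCurvatureAt_of_polar hlap (by rw [h.1]; ring) h.2
    · exact hasZeroMeanCurvatureAt_of_polar hlap (hconf _ hp hr).2.1 (hconf _ hp hr).2.2
  have hba : IsLightlike (a - b) := by
    have := lightlike_smul hab (c := -1) (by norm_num)
    simpa using this
  have hsymm : ∀ x : L3, AffineEquiv.pointReflection ℝ (midpoint ℝ a b) x = (a + b) - x := by
    intro x
    rw [AffineEquiv.pointReflection_apply, midpoint_eq_smul_add]
    funext j
    simp
    ring
  have hseg : ∀ x ∈ segment ℝ a b, (a + b) - x ∈ segment ℝ a b := by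
    rintro _ ⟨s, t, hs, ht, hst, rfl⟩
    refine ⟨t, s, ht, hs, by rw [add_comm, hst], ?_⟩
    funext j
    simp
    linear_combination (a j + b j) * hst
  -- The segment lies in the boundary, which by definition excludes the graph; the case `r < 0`
  -- follows since the segment is symmetric about its midpoint.
  have hdisj : ∀ p ∈ halfStrip, F p ∉ segment ℝ a b := fun p hp hmem =>
    (hL hmem).2 (hbij.mapsTo hp)
  refine ⟨F, hFa, ?_, hzmc, hFX, hbij, ?_, ?_, ?_, ?_⟩
  · rintro ⟨r, θ⟩ hp
    by_cases hr : r = 0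
    · subst hr
      refine polarSweep_injective_fderiv_zero hba ?_ hconj hpos hp
      filter_upwards [hVo.mem_nhds h0V] with ζ hζ j using hV j ζ hζ
    · exact ((hconf _ hp hr).isSpacelikeAt hr).injective_fderiv
  · have h1 : (fun θ : ℝ => F (0, θ)) = fun θ => AffineMap.lineMap b a (θ / Real.pi) :=
      funext fun θ => polarSweep_zero hconj θ
    rw [h1, openSegment_symm, openSegment_eq_image_lineMap]
    have hne : b ≠ a := fun h => hba.1 (by rw [h, sub_self])
    have hdiv : Set.BijOn (fun θ : ℝ => θ / Real.pi) (Set.Ioo 0 Real.pi) (Set.Ioo 0 1) := by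
      refine ⟨fun θ hθ => ⟨div_pos hθ.1 hpi, (div_lt_one hpi).2 hθ.2⟩, fun x _ y _ h => ?_,
        fun t ht => ⟨t * Real.pi, ⟨mul_pos ht.1 hpi, ?_⟩, mul_div_cancel_right₀ _ hpi.ne'⟩⟩
      · exact (div_left_inj' hpi.ne').1 h
      · nlinarith [ht.2]
    exact ((AffineMap.lineMap_injective ℝ hne).injOn.bijOn_image (s := Set.Ioo 0 1)).comp hdiv
  · intro r θ _
    rw [hsymm]
    exact polarSweep_reflect hconj r θ
  · ext x
    constructor
    · rintro ⟨_, ⟨p, hp, rfl⟩, rfl⟩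
      exact ⟨_, hσ p hp, by rw [hrefl, hsymm]⟩
    · rintro ⟨p, hp, rfl⟩
      refine ⟨_, ⟨_, hσ p hp, rfl⟩, ?_⟩
      rw [hsymm, hrefl, sub_sub_cancel]
  · intro p hp hp1
    refine ⟨fun hmem => ?_, (hconf p hp hp1).isSpacelikeAt hp1, hzmc p hp⟩
    rcases lt_or_gt_of_ne hp1 with hneg | hpos'
    · refine hdisj _ (hσhalf p hp hneg) ?_
      rw [hrefl]
      exact hseg _ hmem
    · exact hdisj p ⟨hpos', hp⟩ hmem
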